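/- **Proposition.** Let $R$ be a commutative ring with unit and let $I\lhd R$ be the ideal generated by a finite regular sequence $r_1,\dots,r_n\in R$ (each $r_i$ is a non-zero divisor on $R/(r_1,\dots,r_{i-1})$, and $R/I\neq 0$). Let $\mathrm{gr}_I^*(R)=\bigoplus_{s\ge 0} I^s/I^{s+1}$ and let $$\mathrm{Tor}_*(R/I,\mathrm{gr}_I^*(R))=\bigoplus_{s,k\ge 0}\mathrm{Tor}^R_k(R/I,\,I^s/I^{s+1}),$$ an $R/I$-module bigraded by giving $\mathrm{Tor}^R_k(R/I,I^s/I^{s+1})$ the bidegree $(-s,\,s+k)$; so $I^s/I^{s+1}$ itself sits in bidegree $(-s,s)$. Give it the exterior multiplication induced by the products $I^s/I^{s+1}\times I^t/I^{t+1}\to I^{s+t}/I^{s+t+1}$, formed with the sign rule for bigraded objects. Explicitly: let $P^s$ be a projective resolution of $I^s/I^{s+1}$, with $P^s_k$ in bidegree $(-s,s+k)$. Lift the products to bilinear maps $P^s_i\times P^t_j\to P^{s+t}_{i+j}$ for which the differential is a derivation with respect to the vertical degree, i.e. $d(xy)=(dx)y+(-1)^{s+i}x(dy)$ for $x\in P^s_i$.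 The product on homology is then induced by the maps $(a\otimes x,\,b\otimes y)\mapsto ab\otimes xy$ on $R/I\otimes_R P^s$ and $R/I\otimes_R P^t$. The unit is the class of $1\otimes 1$ in $\mathrm{Tor}_0^R(R/I,R/I)$. Then there is an isomorphism of bigraded $R/I$-algebras $$\mathrm{Tor}_*(R/I,\mathrm{gr}_I^*(R))\;\cong\;\Lambda_{R/I}(e_1,\dots,e_n)\,\tilde\otimes\,R/I[x_1,\dots,x_n],$$ where $e_i$ has bidegree $(0,1)$, $x_i$ has bidegree $(-1,1)$, and $\tilde\otimes$ is the twisted tensor product: the tensor product of modules over $R/I$, with multiplication $(c\otimes d)(c'\otimes d')=(-1)^{kp'+lq'}cc'\otimes dd'$ for $d$ of bidegree $(k,l)$ and $c'$ of bidegree $(p',q')$. In particular $x_ie_j=-e_jx_i$. -/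

import Mathlib

universe u

namespace RegularTor

open CategoryTheory MonoidalCategory DirectSum
open scoped TensorProduct

variable {R : Type u} [CommRing R]

/-! ### The associated graded ring of an ideal -/

/-- The component `I^s / I^(s+1)` of the associated graded ring of `I`. -/
abbrev Gr (I : Ideal R) (s : ℕ) : Type u :=
  ↥(I ^ s) ⧸ (I ^ (s + 1)).submoduleOf (I ^ s)

/-- The multiplication `I^s / I^(s+1) × I^t / I^(t+1) → I^(s+t) / I^(s+t+1)`. -/
noncomputable def grMul (I : Ideal R) (s t : ℕ) : Gr I s →ₗ[R] Gr I t →ₗ[R] Gr I (s + t) :=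
  Submodule.liftQ _
    (LinearMap.mk₂ R
      (fun (x : ↥(I ^ s)) (y : Gr I t) => Submodule.liftQ ((I ^ (t + 1)).submoduleOf (I ^ t))
        ((Submodule.mkQ ((I ^ (s + t + 1)).submoduleOf (I ^ (s + t)))).comp
          (((LinearMap.mulLeft R (x : R)).restrict (p := I ^ t) (q := I ^ (s + t))
            (fun y hy => by rw [pow_add]; exact Ideal.mul_mem_mul x.2 hy))))
        (fun y hy => by
          rw [LinearMap.mem_ker, LinearMap.comp_apply, Submodule.mkQ_apply,
            Submodule.Quotient.mk_eq_zero]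
          have h : (y : R) ∈ I ^ (t + 1) := hy
          change (x : R) * (y : R) ∈ I ^ (s + t + 1)
          rw [add_assoc, pow_add]
          exact Ideal.mul_mem_mul x.2 h) y)
      (fun x x' y => by
        induction y using Submodule.Quotient.induction_on with | _ y =>
        exact congrArg (Submodule.Quotient.mk) (Subtype.ext (add_mul (x : R) x' y)))
      (fun c x y => by
        induction y using Submodule.Quotient.induction_on with | _ y =>
        exact congrArg (Submodule.Quotient.mk) (Subtype.ext (mul_assoc c (x : R) y)))
      (fun x y y' => map_add _ _ _)
      (fun c x y => map_smul _ _ _))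
    (fun x hx => by
      rw [LinearMap.mem_ker]
      ext y
      have h : (x : R) ∈ I ^ (s + 1) := hx
      refine (Submodule.Quotient.mk_eq_zero _).2 ?_
      change (x : R) * (y : R) ∈ I ^ (s + t + 1)
      rw [show s + t + 1 = s + 1 + t by omega, pow_add]
      exact Ideal.mul_mem_mul h y.2)

theorem grMul_mk (I : Ideal R) (s t : ℕ) (x : ↥(I ^ s)) (y : ↥(I ^ t)) :
    grMul I s t (Submodule.Quotient.mk x) (Submodule.Quotient.mk y) =
      Submodule.Quotient.mk
        ⟨(x : R) * (y : R), by rw [pow_add]; exact Ideal.mul_mem_mul x.2 y.2⟩ :=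
  rfl

/-- The unit of the associated graded ring, the class of `1` in `I^0 / I^1`. -/
def grOne (I : Ideal R) : Gr I 0 :=
  Submodule.Quotient.mk ⟨1, by simp⟩

/-! ### Pairings of projective resolutions -/

/-- Let `P`, `Q`, `T` be projective resolutions of `M`, `N`, `L`, where the bottom term of `P` is
placed in vertical degree `s`, so that the `i`-th term of `P` has vertical degree `s + i`. A pairing
of resolutions over a bilinear map `β : M × N → L` consists of bilinear maps
`P_i × Q_j → T_(i+j)` lifting `β` such that the differential is a derivation for the vertical
degree: `d (x y) = (d x) y + (-1)^(s+i) x (d y)` for `x ∈ P_i`.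
(`map i j k` is relevant only for `k = i + j`; the differential `d 0 0` is zero, so the first term on
the right vanishes for `i = 0` and the second one for `j = 0`.) -/
structure Pairing {M N L : ModuleCat.{u} R} (P : ProjectiveResolution M)
    (Q : ProjectiveResolution N) (T : ProjectiveResolution L) (β : M →ₗ[R] N →ₗ[R] L)
    (s : ℕ) where
  /-- the bilinear maps -/
  map : ∀ i j k : ℕ, P.complex.X i →ₗ[R] Q.complex.X j →ₗ[R] T.complex.X k
  leibniz : ∀ i j k : ℕ, i + j = k + 1 → ∀ (x : P.complex.X i) (y : Q.complex.X j),
    (T.complex.d (k + 1) k).hom (map i j (k + 1) x y) =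
      map (i - 1) j k ((P.complex.d i (i - 1)).hom x) y +
        (-1 : ℤ) ^ (s + i) • map i (j - 1) k x ((Q.complex.d j (j - 1)).hom y)
  augmentation : ∀ (x : P.complex.X 0) (y : Q.complex.X 0),
    (T.π.f 0).hom (map 0 0 0 x y) = β ((P.π.f 0).hom x) ((Q.π.f 0).hom y)

theorem exists_bilinear_lift {X Y Z W : Type u} [AddCommGroup X] [Module R X] [AddCommGroup Y]
    [Module R Y] [AddCommGroup Z] [Module R Z] [AddCommGroup W] [Module R W]
    [Module.Projective R X] [Module.Projective R Y]
    (f : X →ₗ[R] Y →ₗ[R] Z) (d : W →ₗ[R] Z) (h : ∀ x y, f x y ∈ LinearMap.range d) :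
    ∃ g : X →ₗ[R] Y →ₗ[R] W, ∀ x y, d (g x y) = f x y := by
  have h' : ∀ z, TensorProduct.lift f z ∈ LinearMap.range d := by
    intro z
    induction z with
    | zero => simp
    | tmul x y => simpa using h x y
    | add a b ha hb => rw [map_add]; exact add_mem ha hb
  obtain ⟨g, hg⟩ := Module.projective_lifting_property d.rangeRestrict
    ((TensorProduct.lift f).codRestrict _ h') d.surjective_rangeRestrict
  refine ⟨(TensorProduct.mk R X Y).compr₂ g, fun x y => ?_⟩
  have := congrArg Subtype.val (LinearMap.congr_fun hg (x ⊗ₜ y))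
  simpa using this

theorem projective_term {M : ModuleCat.{u} R} (P : ProjectiveResolution M) (i : ℕ) :
    Module.Projective R (P.complex.X i) :=
  (IsProjective.iff_projective (R := R) (P.complex.X i)).2 (P.projective i)

theorem d_d {K : ChainComplex (ModuleCat.{u} R) ℕ} (i j k : ℕ) (x : K.X i) :
    (K.d j k).hom ((K.d i j).hom x) = 0 := by
  rw [← LinearMap.comp_apply, ← ModuleCat.hom_comp, K.d_comp_d]; rfl

theorem d_pred_zero {K : ChainComplex (ModuleCat.{u} R) ℕ} (x : K.X 0) :
    (K.d 0 (0 - 1)).hom x = 0 := by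
  rw [K.shape _ _ (by simp)]; rfl

section Existence

variable {M N L : ModuleCat.{u} R} (P : ProjectiveResolution M)
    (Q : ProjectiveResolution N) (T : ProjectiveResolution L) (β : M →ₗ[R] N →ₗ[R] L) (s : ℕ)

/-- The right-hand side of the Leibniz rule. -/
noncomputable def rhs {Z : Type u} [AddCommGroup Z] [Module R Z]
    (m : ∀ i j : ℕ, P.complex.X i →ₗ[R] Q.complex.X j →ₗ[R] Z) (i j : ℕ) :
    P.complex.X i →ₗ[R] Q.complex.X j →ₗ[R] Z :=
  (m (i - 1) j).comp (P.complex.d i (i - 1)).hom +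
    (-1 : ℤ) ^ (s + i) • (m i (j - 1)).compl₂ (Q.complex.d j (j - 1)).hom

theorem rhs_apply {Z : Type u} [AddCommGroup Z] [Module R Z]
    (m : ∀ i j : ℕ, P.complex.X i →ₗ[R] Q.complex.X j →ₗ[R] Z) (i j : ℕ)
    (x : P.complex.X i) (y : Q.complex.X j) :
    rhs P Q s m i j x y = m (i - 1) j ((P.complex.d i (i - 1)).hom x) y +
        (-1 : ℤ) ^ (s + i) • m i (j - 1) x ((Q.complex.d j (j - 1)).hom y) := rfl

theorem rhs_rhs {Z : Type u} [AddCommGroup Z] [Module R Z]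
    (m : ∀ i j : ℕ, P.complex.X i →ₗ[R] Q.complex.X j →ₗ[R] Z) (i j : ℕ)
    (x : P.complex.X i) (y : Q.complex.X j) :
    rhs P Q s (rhs P Q s m) i j x y = 0 := by
  rw [rhs_apply, rhs_apply, rhs_apply, d_d, d_d]
  rcases i with _ | i
  · rw [d_pred_zero]; simp
  rcases j with _ | j
  · simp
  · simp only [Nat.add_sub_cancel, map_zero, LinearMap.zero_apply, zero_add, smul_zero, add_zero]
    rw [← add_smul, ← add_assoc s i 1, pow_succ]
    simp

theorem exists_step (k : ℕ)
    (m : ∀ i j : ℕ, P.complex.X i →ₗ[R] Q.complex.X j →ₗ[R] T.complex.X k)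
    (h : ∀ i j, i + j = k + 1 → ∀ x y, rhs P Q s m i j x y ∈
      LinearMap.range (T.complex.d (k + 1) k).hom) :
    ∃ m' : ∀ i j : ℕ, P.complex.X i →ₗ[R] Q.complex.X j →ₗ[R] T.complex.X (k + 1),
      (∀ i j, i + j = k + 1 → ∀ x y,
        (T.complex.d (k + 1) k).hom (m' i j x y) = rhs P Q s m i j x y) ∧
      ∀ i j, i + j = k + 2 → ∀ x y, rhs P Q s m' i j x y ∈
        LinearMap.range (T.complex.d (k + 2) (k + 1)).hom := by
  have key : ∀ i j, ∃ g : P.complex.X i →ₗ[R] Q.complex.X j →ₗ[R] T.complex.X (k + 1),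
      i + j = k + 1 → ∀ x y, (T.complex.d (k + 1) k).hom (g x y) = rhs P Q s m i j x y := by
    intro i j
    by_cases hij : i + j = k + 1
    · have := projective_term P i
      have := projective_term Q j
      obtain ⟨g, hg⟩ := exists_bilinear_lift _ _ (h i j hij)
      exact ⟨g, fun _ => hg⟩
    · exact ⟨0, fun h => absurd h hij⟩
  choose m' hm' using key
  refine ⟨m', hm', fun i j hij x y => ?_⟩
  have ex := (ShortComplex.moduleCat_exact_iff_range_eq_ker _).1 (T.exact_succ k)
  have ex' : LinearMap.range (T.complex.d (k + 2) (k + 1)).hom =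
    LinearMap.ker (T.complex.d (k + 1) k).hom := ex
  rw [ex', LinearMap.mem_ker, ← rhs_rhs P Q s m i j x y, rhs_apply, rhs_apply, map_add,
    map_zsmul]
  congr 1
  · rcases i with _ | i
    · simp
    · exact hm' _ _ (by omega) _ _
  · congr 1
    rcases j with _ | j
    · simp
    · exact hm' _ _ (by omega) _ _

theorem exists_zero :
    ∃ m : ∀ i j : ℕ, P.complex.X i →ₗ[R] Q.complex.X j →ₗ[R] T.complex.X 0,
      (∀ x y, (T.π.f 0).hom (m 0 0 x y) = β ((P.π.f 0).hom x) ((Q.π.f 0).hom y)) ∧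
      ∀ i j, i + j = 1 → ∀ x y, rhs P Q s m i j x y ∈
        LinearMap.range (T.complex.d 1 0).hom := by
  have hsurj : Function.Surjective (T.π.f 0).hom := (ModuleCat.epi_iff_surjective _).1 inferInstance
  have := projective_term P 0
  have := projective_term Q 0
  let f : P.complex.X 0 →ₗ[R] Q.complex.X 0 →ₗ[R] L :=
    β.compl₁₂ (P.π.f 0).hom (Q.π.f 0).hom
  obtain ⟨g, hg⟩ := exists_bilinear_lift (W := T.complex.X 0) f (T.π.f 0).hom
    (fun x y => LinearMap.mem_range.2 (hsurj _))
  have ex : ∀ z : T.complex.X 0, (T.π.f 0).hom z = 0 →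
      z ∈ LinearMap.range (T.complex.d 1 0).hom := by
    intro z hz
    have e := (ShortComplex.moduleCat_exact_iff_range_eq_ker _).1
      (ShortComplex.exact_of_g_is_cokernel
        (ShortComplex.mk _ _ T.complex_d_comp_π_f_zero) T.isColimitCokernelCofork)
    have e' : LinearMap.range (T.complex.d 1 0).hom = LinearMap.ker (T.π.f 0).hom := e
    rw [e']; exact hz
  have hP : ∀ x, (P.π.f 0).hom ((P.complex.d 1 0).hom x) = 0 := fun x => by
    rw [← LinearMap.comp_apply, ← ModuleCat.hom_comp, P.complex_d_comp_π_f_zero]; rfl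
  have hQ : ∀ x, (Q.π.f 0).hom ((Q.complex.d 1 0).hom x) = 0 := fun x => by
    rw [← LinearMap.comp_apply, ← ModuleCat.hom_comp, Q.complex_d_comp_π_f_zero]; rfl
  refine ⟨fun i j => match i, j with
    | 0, 0 => g
    | _, _ => 0, hg, ?_⟩
  intro i j hij x y
  obtain ⟨rfl, rfl⟩ | ⟨rfl, rfl⟩ : (i = 0 ∧ j = 1) ∨ (i = 1 ∧ j = 0) := by omega
  · rw [rhs_apply, d_pred_zero, map_zero, LinearMap.zero_apply, zero_add]
    refine zsmul_mem (ex _ ?_) _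
    refine (hg _ _).trans ?_
    exact (congrArg (β _) (hQ y)).trans (map_zero _)
  · rw [rhs_apply, d_pred_zero, map_zero, smul_zero, add_zero]
    refine ex _ ?_
    refine (hg _ _).trans ?_
    refine (congrArg (fun z => β z _) (hP x)).trans ?_
    exact LinearMap.congr_fun (map_zero β) _

theorem nonempty_pairing : Nonempty (Pairing P Q T β s) := by
  obtain ⟨m₀, h₀, h₀'⟩ := exists_zero P Q T β s
  let S : ℕ → Type u := fun k =>
    {m : ∀ i j : ℕ, P.complex.X i →ₗ[R] Q.complex.X j →ₗ[R] T.complex.X k //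
      ∀ i j, i + j = k + 1 → ∀ x y, rhs P Q s m i j x y ∈
        LinearMap.range (T.complex.d (k + 1) k).hom}
  choose step hstep hstep' using exists_step P Q T s
  let F : ∀ k, S k := fun k => Nat.rec (motive := S) ⟨m₀, h₀'⟩
    (fun k m => ⟨step k m.1 m.2, hstep' k m.1 m.2⟩) k
  exact ⟨{
    map := fun i j k => (F k).1 i j
    leibniz := fun i j k hij x y => hstep k (F k).1 (F k).2 i j hij x y
    augmentation := h₀ }⟩

end Existence

/-! ### Tor and its exterior product -/

section Homology

/-- The homology of a complex of modules in degree `i`, as cycles modulo boundaries. -/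
abbrev Homology (K : ChainComplex (ModuleCat.{u} R) ℕ) (i : ℕ) : Type u :=
  LinearMap.ker (K.d i (i - 1)).hom ⧸
    (LinearMap.range (K.d (i + 1) i).hom).submoduleOf (LinearMap.ker (K.d i (i - 1)).hom)

/-- Mathlib's homology agrees with cycles modulo boundaries. -/
noncomputable def homologyEquiv (K : ChainComplex (ModuleCat.{u} R) ℕ) (i : ℕ) :
    K.homology i ≃ₗ[R] Homology K i :=
  (ShortComplex.homologyMapIso (K.isoSc' (i + 1) i (i - 1) (by simp)
      (by cases i <;> simp)) ≪≫
    (K.sc' (i + 1) i (i - 1)).moduleCatHomologyIso).toLinearEquiv.trans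
  (Submodule.quotEquivOfEq _ _ (by
    ext x
    constructor
    · rintro ⟨y, rfl⟩
      exact ⟨y, rfl⟩
    · rintro ⟨y, hy⟩
      exact ⟨y, Subtype.ext hy⟩))

/-- Bilinear maps `K_i × L_j → N_(i+j)` for which the differential is a derivation up to sign induce
bilinear maps on homology. -/
noncomputable def homologyMul {K L N : ChainComplex (ModuleCat.{u} R) ℕ} (s : ℕ)
    (m : ∀ i j k : ℕ, K.X i →ₗ[R] L.X j →ₗ[R] N.X k)
    (hm : ∀ i j k : ℕ, i + j = k + 1 → ∀ (x : K.X i) (y : L.X j),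
      (N.d (k + 1) k).hom (m i j (k + 1) x y) =
        m (i - 1) j k ((K.d i (i - 1)).hom x) y +
          (-1 : ℤ) ^ (s + i) • m i (j - 1) k x ((L.d j (j - 1)).hom y))
    (i j : ℕ) : Homology K i →ₗ[R] Homology L j →ₗ[R] Homology N (i + j) :=
  have hcyc : ∀ x ∈ LinearMap.ker (K.d i (i - 1)).hom, ∀ y ∈ LinearMap.ker (L.d j (j - 1)).hom,
      m i j (i + j) x y ∈ LinearMap.ker (N.d (i + j) (i + j - 1)).hom := by
    intro x hx y hy
    rw [LinearMap.mem_ker] at hx hy ⊢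
    obtain h | ⟨k, h⟩ : i + j = 0 ∨ ∃ k, i + j = k + 1 := by
      rcases i + j with _ | k
      · exact Or.inl rfl
      · exact Or.inr ⟨k, rfl⟩
    · rw [h]; exact d_pred_zero _
    · rw [h]
      refine (hm i j k h x y).trans ?_
      rw [hx, hy]
      simp
  have hleft : ∀ x ∈ LinearMap.range (K.d (i + 1) i).hom,
      ∀ y ∈ LinearMap.ker (L.d j (j - 1)).hom,
      m i j (i + j) x y ∈ LinearMap.range (N.d (i + j + 1) (i + j)).hom := by
    rintro _ ⟨x, rfl⟩ y hy
    rw [LinearMap.mem_ker] at hy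
    refine ⟨m (i + 1) j (i + j + 1) x y, (hm (i + 1) j (i + j) (by omega) x y).trans ?_⟩
    rw [hy, map_zero, smul_zero, add_zero]
    rfl
  have hright : ∀ x ∈ LinearMap.ker (K.d i (i - 1)).hom,
      ∀ y ∈ LinearMap.range (L.d (j + 1) j).hom,
      m i j (i + j) x y ∈ LinearMap.range (N.d (i + j + 1) (i + j)).hom := by
    rintro x hx _ ⟨y, rfl⟩
    rw [LinearMap.mem_ker] at hx
    have h := hm i (j + 1) (i + j) (by omega) x y
    rw [hx, map_zero, LinearMap.zero_apply, zero_add] at h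
    refine ⟨(-1 : ℤ) ^ (s + i) • m i (j + 1) (i + j + 1) x y, ?_⟩
    rw [map_zsmul, h, smul_smul, ← mul_pow]
    simp
  Submodule.liftQ _
    (LinearMap.mk₂ R
      (fun (x : LinearMap.ker (K.d i (i - 1)).hom) (y : Homology L j) =>
        Submodule.mapQ _
          ((LinearMap.range (N.d (i + j + 1) (i + j)).hom).submoduleOf
            (LinearMap.ker (N.d (i + j) (i + j - 1)).hom))
          ((m i j (i + j) x).restrict (fun y hy => hcyc x x.2 y hy))
          (fun y hy => hright x x.2 (y : L.X j) hy) y)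
      (fun x x' y => by
        induction y using Submodule.Quotient.induction_on with | _ y =>
        exact congrArg Submodule.Quotient.mk (Subtype.ext
          (LinearMap.congr_fun (map_add (m i j (i + j)) (x : K.X i) x') y)))
      (fun c x y => by
        induction y using Submodule.Quotient.induction_on with | _ y =>
        exact congrArg Submodule.Quotient.mk (Subtype.ext
          (LinearMap.congr_fun (map_smul (m i j (i + j)) c (x : K.X i)) y)))
      (fun x y y' => map_add _ _ _)
      (fun c x y => map_smul _ _ _))
    (fun x hx => by
      rw [LinearMap.mem_ker]
      ext y
      exact (Submodule.Quotient.mk_eq_zero _).2 (hleft x hx y y.2))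

end Homology

section Tor

variable (I : Ideal R)

/-- `Tor_k^R(R/I, M)`. -/
noncomputable abbrev TorMod (M : ModuleCat.{u} R) (k : ℕ) : ModuleCat.{u} R :=
  ((Tor (ModuleCat.{u} R) k).obj (ModuleCat.of R (R ⧸ I))).obj M

/-- The complex `R/I ⊗ P`. -/
noncomputable abbrev tensorComplex {M : ModuleCat.{u} R} (P : ProjectiveResolution M) :
    ChainComplex (ModuleCat.{u} R) ℕ :=
  (((tensoringLeft (ModuleCat.{u} R)).obj (ModuleCat.of R (R ⧸ I))).mapHomologicalComplex
    (ComplexShape.down ℕ)).obj P.complex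

/-- `Tor_k^R(R/I, M)` is the homology of `R/I ⊗ P` for a projective resolution `P` of `M`. -/
noncomputable def torEquiv {M : ModuleCat.{u} R} (P : ProjectiveResolution M) (k : ℕ) :
    TorMod I M k ≃ₗ[R] Homology (tensorComplex I P) k :=
  (P.isoLeftDerivedObj ((tensoringLeft (ModuleCat.{u} R)).obj
    (ModuleCat.of R (R ⧸ I))) k).toLinearEquiv.trans (homologyEquiv (tensorComplex I P) k)

theorem tensor_leibniz {A X X' Y Y' Z W : Type u} [CommRing A] [Algebra R A]
    [AddCommGroup X] [Module R X] [AddCommGroup X'] [Module R X'] [AddCommGroup Y] [Module R Y]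
    [AddCommGroup Y'] [Module R Y'] [AddCommGroup Z] [Module R Z] [AddCommGroup W] [Module R W]
    (dX : X →ₗ[R] X') (dY : Y →ₗ[R] Y') (d : W →ₗ[R] Z) (m : X →ₗ[R] Y →ₗ[R] W)
    (m₁ : X' →ₗ[R] Y →ₗ[R] Z) (m₂ : X →ₗ[R] Y' →ₗ[R] Z) (ε : ℤ)
    (h : ∀ x y, d (m x y) = m₁ (dX x) y + ε • m₂ x (dY y)) (x : A ⊗[R] X) (y : A ⊗[R] Y) :
    d.lTensor A (TensorProduct.map₂ (LinearMap.mul R A) m x y) =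
      TensorProduct.map₂ (LinearMap.mul R A) m₁ (dX.lTensor A x) y +
        ε • TensorProduct.map₂ (LinearMap.mul R A) m₂ x (dY.lTensor A y) := by
  induction x with
  | zero => simp
  | add x x' hx hx' =>
    simp only [map_add, LinearMap.add_apply, hx, hx', smul_add]
    abel
  | tmul a x =>
    induction y with
    | zero => simp
    | add y y' hy hy' =>
      simp only [map_add, hy, hy', smul_add]
      abel
    | tmul b y =>
      simp [h, TensorProduct.tmul_add]

/-- The product `Tor_i(R/I, M) × Tor_j(R/I, N) → Tor_(i+j)(R/I, L)` given by a pairing of projective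
resolutions: it is induced by the maps `(a ⊗ x, b ⊗ y) ↦ a b ⊗ x y` on `(R/I ⊗ P) × (R/I ⊗ Q)`. -/
noncomputable def Pairing.torMul {M N L : ModuleCat.{u} R} {P : ProjectiveResolution M}
    {Q : ProjectiveResolution N} {T : ProjectiveResolution L} {β : M →ₗ[R] N →ₗ[R] L} {s : ℕ}
    (φ : Pairing P Q T β s) (i j : ℕ) :
    TorMod I M i →ₗ[R] TorMod I N j →ₗ[R] TorMod I L (i + j) :=
  ((homologyMul (K := tensorComplex I P) (L := tensorComplex I Q) (N := tensorComplex I T) s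
      (fun i j k => TensorProduct.map₂ (LinearMap.mul R (R ⧸ I)) (φ.map i j k))
      (fun i j k h x y => tensor_leibniz (A := R ⧸ I) (P.complex.d i (i - 1)).hom
        (Q.complex.d j (j - 1)).hom (T.complex.d (k + 1) k).hom (φ.map i j (k + 1))
        (φ.map (i - 1) j k) (φ.map i (j - 1) k) _ (φ.leibniz i j k h) x y) i j).compl₁₂
      (torEquiv I P i).toLinearMap (torEquiv I Q j).toLinearMap).compr₂
    (torEquiv I T (i + j)).symm.toLinearMap

/-- The exterior product `Tor_i(R/I, M) × Tor_j(R/I, N) → Tor_(i+j)(R/I, L)` over a bilinear map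
`β : M × N → L`, where `M` is placed in vertical degree `s`. It is computed by a pairing of
projective resolutions over `β`; such a pairing exists, and it is unique up to homotopy. -/
noncomputable def torMul {M N L : ModuleCat.{u} R} (β : M →ₗ[R] N →ₗ[R] L) (s i j : ℕ) :
    TorMod I M i →ₗ[R] TorMod I N j →ₗ[R] TorMod I L (i + j) :=
  (nonempty_pairing (projectiveResolution M) (projectiveResolution N)
    (projectiveResolution L) β s).some.torMul I i j

/-- The class in `Tor_0(R/I, M) = R/I ⊗ M` of `1 ⊗ m`. -/
noncomputable def torZero {M : ModuleCat.{u} R} (m : M) : TorMod I M 0 :=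
  (((tensoringLeft (ModuleCat.{u} R)).obj
    (ModuleCat.of R (R ⧸ I))).leftDerivedZeroIsoSelf.inv.app M).hom
      ((1 : R ⧸ I) ⊗ₜ[R] m : (R ⧸ I) ⊗[R] M)

theorem isTorsionBySet_torMod (M : ModuleCat.{u} R) (k : ℕ) :
    Module.IsTorsionBySet R (TorMod I M k) I := by
  intro x r
  let P := projectiveResolution M
  apply (torEquiv I P k).injective
  rw [map_smul, map_zero]
  induction (torEquiv I P k x) using Submodule.Quotient.induction_on with | _ z =>
  rw [← Submodule.Quotient.mk_smul]
  have hz : (r : R) • z = 0 := by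
    apply Subtype.ext
    have key : ∀ w : (R ⧸ I) ⊗[R] P.complex.X k, (r : R) • w = 0 := by
      intro w
      induction w with
      | zero => simp
      | add a b ha hb => rw [smul_add, ha, hb, add_zero]
      | tmul a b =>
        rw [TensorProduct.smul_tmul', Algebra.smul_def]
        have : algebraMap R (R ⧸ I) r = 0 := Ideal.Quotient.eq_zero_iff_mem.2 r.2
        rw [this, zero_mul, TensorProduct.zero_tmul]
    exact key z.1
  rw [hz, Submodule.Quotient.mk_zero]

end Tor

/-! ### The bigraded algebra `Tor_*(R/I, gr_I^*(R))` -/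

section TorGr

variable (I : Ideal R)

/-- The component `Tor_k^R(R/I, I^s / I^(s+1))` of `Tor_*(R/I, gr_I^*(R))`, for `p = (s, k)`.
Its bidegree is `(-s, s + k)`. -/
def TorPiece (p : ℕ × ℕ) : Type u := TorMod I (ModuleCat.of R (Gr I p.1)) p.2

noncomputable instance (p : ℕ × ℕ) : AddCommGroup (TorPiece I p) :=
  inferInstanceAs (AddCommGroup (TorMod I (ModuleCat.of R (Gr I p.1)) p.2))

noncomputable instance (p : ℕ × ℕ) : Module R (TorPiece I p) :=
  inferInstanceAs (Module R (TorMod I (ModuleCat.of R (Gr I p.1)) p.2))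

/-- As `R/I` is killed by `I`, so is Tor, which is therefore an `R/I`-module. -/
noncomputable instance (p : ℕ × ℕ) : Module (R ⧸ I) (TorPiece I p) :=
  Module.IsTorsionBySet.module (isTorsionBySet_torMod I (ModuleCat.of R (Gr I p.1)) p.2)

/-- The exterior product of the components, induced by the multiplication of `gr_I^*(R)`; the
module `I^s / I^(s+1)` is placed in bidegree `(-s, s)`. -/
noncomputable def pieceMul (p q : ℕ × ℕ) :
    TorPiece I p →ₗ[R] TorPiece I q →ₗ[R] TorPiece I (p + q) :=
  torMul I (M := ModuleCat.of R (Gr I p.1)) (N := ModuleCat.of R (Gr I q.1))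
    (L := ModuleCat.of R (Gr I (p.1 + q.1))) (grMul I p.1 q.1) p.1 p.2 q.2

noncomputable instance : DirectSum.GNonUnitalNonAssocSemiring (TorPiece I) where
  mul {p q} x y := pieceMul I p q x y
  mul_zero {p q} x := map_zero (pieceMul I p q x)
  zero_mul {p q} y := LinearMap.congr_fun (map_zero (pieceMul I p q)) y
  mul_add {p q} x := map_add (pieceMul I p q x)
  add_mul {p q} x x' y := LinearMap.congr_fun (map_add (pieceMul I p q) x x') y

/-- The unit is `1 ⊗ 1 ∈ R/I ⊗ R/I = Tor_0(R/I, R/I)`. -/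
noncomputable instance : GradedMonoid.GOne (TorPiece I) where
  one := torZero I (M := ModuleCat.of R (Gr I 0)) (grOne I)

/-- `Tor_*(R/I, gr_I^*(R))`. -/
abbrev TorGr : Type u := ⨁ p : ℕ × ℕ, TorPiece I p

end TorGr

/-! ### The twisted tensor product of an exterior and a polynomial algebra -/

section Twisted

variable (A : Type u) [CommRing A] (n : ℕ)

attribute [local instance] MvPolynomial.gradedAlgebra

/-- The twisted tensor product `Λ_A(e_1, …, e_n) ⊗̃ A[x_1, …, x_n]`, where the `e_i` have bidegree
`(0, 1)` and the `x_i` have bidegree `(-1, 1)`. Elements of the exterior algebra have horizontal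
degree zero, so the sign in `(a ⊗ f) (b ⊗ g) = ± a b ⊗ f g` is `-1` to the product of the vertical
degrees of `f` and `b`. -/
noncomputable abbrev Twisted : Type u :=
  GradedTensorProduct A (fun k : ℕ => ⋀[A]^k (Fin n → A))
    (MvPolynomial.homogeneousSubmodule (Fin n) A)

/-- The component `Λ^k ⊗ A[x_1, …, x_n]_s` of bidegree `(-s, s + k)`. -/
noncomputable def twistedPiece (s k : ℕ) : Submodule A (Twisted A n) :=
  Submodule.span A {z | ∃ a ∈ ⋀[A]^k (Fin n → A),
    ∃ f ∈ MvPolynomial.homogeneousSubmodule (Fin n) A s,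
      z = GradedTensorProduct.tmul A a f}

end Twisted

end RegularTor

/-! Let V = R^n, let f be the linear form on V with values r_i, and let S^s be the free module of
forms of degree s in x_1, …, x_n. Regularity enters twice. It makes the Koszul complex, ΛV with
contraction by f as differential, a resolution of R/I (`koszulExact_seqForm`). It also makes the
sequence quasi-regular (`quasiRegularAt_univ`): the kernel of S^s → I^s / I^(s+1), x_i ↦ r_i, is I ·
S^s. Both facts are inductions on the length of the sequence, with inductive steps
`KoszulExact.extend` and `QuasiRegularAt.insert`. As S^s is flat, ΛV ⊗ S^s is therefore a projective
resolution of I^s / I^(s+1) (`koszulResolution`).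

The Koszul differential has coefficients in I, so it vanishes after tensoring with R/I. Hence
Tor_k(R/I, I^s / I^(s+1)) is R/I ⊗ Λ^k V ⊗ S^s, with no homology left to compute.

For the product, put (u ⊗ F)(v ⊗ G) = (-1)^(s j) uv ⊗ FG, where F has degree s and v has degree j.
Contraction is an antiderivation, and this sign is what turns its Leibniz rule into the one for the
vertical degree s + i, so the formula defines a pairing of resolutions over the product of the
graded ring (`koszulPairing`). Any two pairings over the same bilinear map are homotopic
(`exists_bilinear_homotopy`), so the product on Tor may be computed with this one
(`Pairing.torMul_eq`). The sign is also the one of the twisted tensor product, where F is moved past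
v; the identification is therefore multiplicative. -/

namespace RegularTor

open CategoryTheory MonoidalCategory DirectSum
open scoped TensorProduct

/-! ### Exactness of the Koszul complex of a regular sequence -/

section Koszul

variable {R M N : Type*} [CommRing R] [AddCommGroup M] [Module R M] [AddCommGroup N] [Module R N]

/-- The Koszul differential on the exterior algebra: contraction with a linear form. -/
noncomputable def koszulD (f : Module.Dual R M) : ExteriorAlgebra R M →ₗ[R] ExteriorAlgebra R M :=
  CliffordAlgebra.contractLeft (Q := (0 : QuadraticForm R M)) f

theorem koszulD_ι_mul (f : Module.Dual R M) (m : M) (x : ExteriorAlgebra R M) :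
    koszulD f (ExteriorAlgebra.ι R m * x) = f m • x - ExteriorAlgebra.ι R m * koszulD f x :=
  CliffordAlgebra.contractLeft_ι_mul (Q := (0 : QuadraticForm R M)) f m x

theorem koszulD_ι (f : Module.Dual R M) (m : M) :
    koszulD f (ExteriorAlgebra.ι R m) = algebraMap R _ (f m) :=
  CliffordAlgebra.contractLeft_ι (0 : QuadraticForm R M) f m

theorem koszulD_algebraMap (f : Module.Dual R M) (c : R) :
    koszulD f (algebraMap R _ c) = 0 :=
  CliffordAlgebra.contractLeft_algebraMap (0 : QuadraticForm R M) f c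

theorem koszulD_koszulD (f : Module.Dual R M) (x : ExteriorAlgebra R M) :
    koszulD f (koszulD f x) = 0 :=
  CliffordAlgebra.contractLeft_contractLeft (Q := (0 : QuadraticForm R M)) f x

theorem ι_mul_mem (m : M) {k : ℕ} {x : ExteriorAlgebra R M} (hx : x ∈ ⋀[R]^k M) :
    ExteriorAlgebra.ι R m * x ∈ ⋀[R]^(k + 1) M := by
  rw [ExteriorAlgebra.exteriorPower, pow_succ']
  exact Submodule.mul_mem_mul ⟨m, rfl⟩ hx

-- The exterior power is by definition a power of the submodule of vectors inside the exterior
-- algebra, so induction on powers from the left applies.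
@[elab_as_elim]
theorem exteriorPower_induction {p : ∀ (k : ℕ) (x : ExteriorAlgebra R M), x ∈ ⋀[R]^k M → Prop}
    (algebraMap : ∀ c : R, p 0 (algebraMap R _ c) (Submodule.mem_one.2 ⟨c, rfl⟩))
    (add : ∀ k x y hx hy, p k x hx → p k y hy → p k (x + y) (add_mem hx hy))
    (ι_mul : ∀ k m x hx, p k x hx → p (k + 1) (ExteriorAlgebra.ι R m * x) (ι_mul_mem m hx))
    {k : ℕ} {x : ExteriorAlgebra R M} (hx : x ∈ ⋀[R]^k M) : p k x hx := by
  induction hx using Submodule.pow_induction_on_left' with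
  | algebraMap c => exact algebraMap c
  | add x y i hx hy ihx ihy => exact add i x y hx hy ihx ihy
  | mem_mul m hm i x hx ih =>
    obtain ⟨m, rfl⟩ := hm
    exact ι_mul i m x hx ih

/-- The truncated `k - 1` is harmless: for `k = 0` the differential kills scalars. -/
theorem koszulD_mem (f : Module.Dual R M) {k : ℕ} {x : ExteriorAlgebra R M}
    (hx : x ∈ ⋀[R]^k M) : koszulD f x ∈ ⋀[R]^(k - 1) M := by
  induction hx using exteriorPower_induction with
  | algebraMap c => rw [koszulD_algebraMap]; exact zero_mem _
  | add k x y _ _ hx hy => rw [map_add]; exact add_mem hx hy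
  | ι_mul k m x hx ih =>
    rw [koszulD_ι_mul]
    refine sub_mem (Submodule.smul_mem _ _ hx) ?_
    -- For a scalar `x` the remaining term would have degree one instead of zero, but it vanishes.
    rcases k with _ | k
    · obtain ⟨c, rfl⟩ := Submodule.mem_one.1 hx
      rw [koszulD_algebraMap, mul_zero]
      exact zero_mem _
    · exact ι_mul_mem m ih

/-- Contraction is an antiderivation: moving it past each vector factor of `x` costs one sign. Only
the left factor has to be homogeneous. -/
theorem koszulD_mul (f : Module.Dual R M) {k : ℕ} {x : ExteriorAlgebra R M}
    (hx : x ∈ ⋀[R]^k M) (y : ExteriorAlgebra R M) :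
    koszulD f (x * y) = koszulD f x * y + (-1 : ℤ) ^ k • (x * koszulD f y) := by
  induction hx using exteriorPower_induction with
  | algebraMap c =>
    rw [koszulD_algebraMap, ← Algebra.smul_def, map_smul, ← Algebra.smul_def]
    simp
  | add k x x' _ _ hx hx' =>
    rw [add_mul, map_add, map_add, hx, hx', add_mul, add_mul, smul_add]
    abel
  | ι_mul k m x _ ih =>
    rw [mul_assoc, koszulD_ι_mul, koszulD_ι_mul, ih, pow_succ, mul_add, sub_mul, smul_mul_assoc,
      mul_assoc, mul_assoc, mul_smul_comm]
    simp only [mul_neg, mul_one, neg_smul]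
    abel

theorem koszulD_map (g : M →ₗ[R] N) (f : Module.Dual R N) (x : ExteriorAlgebra R M) :
    koszulD f (ExteriorAlgebra.map g x) = ExteriorAlgebra.map g (koszulD (f.comp g) x) := by
  induction x using CliffordAlgebra.left_induction with
  | algebraMap c => erw [koszulD_algebraMap, AlgHom.commutes, koszulD_algebraMap, map_zero]
  | add x y hx hy => simp only [map_add, hx, hy]
  | ι_mul x m ih =>
    change koszulD f (ExteriorAlgebra.map g (ExteriorAlgebra.ι R m * x)) =
      ExteriorAlgebra.map g (koszulD (f.comp g) (ExteriorAlgebra.ι R m * x))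
    rw [map_mul, ExteriorAlgebra.map_apply_ι, koszulD_ι_mul, ih, koszulD_ι_mul, map_sub, map_smul,
      map_mul, ExteriorAlgebra.map_apply_ι]
    rfl

theorem map_mem_exteriorPower (g : M →ₗ[R] N) {k : ℕ} {x : ExteriorAlgebra R M}
    (hx : x ∈ ⋀[R]^k M) : ExteriorAlgebra.map g x ∈ ⋀[R]^k N := by
  induction hx using exteriorPower_induction with
  | algebraMap c => rw [AlgHom.commutes]; exact Submodule.mem_one.2 ⟨c, rfl⟩
  | add k x y _ _ hx hy => rw [map_add]; exact add_mem hx hy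
  | ι_mul k m x _ ih =>
    rw [map_mul, ExteriorAlgebra.map_apply_ι]; exact ι_mul_mem _ ih

/-- If `N = M ⊕ R e`, then `⋀ N = ⋀ M ⊕ e ⋀ M`. -/
theorem map_map_add_ι_mul (j : M →ₗ[R] N) (p : N →ₗ[R] M) (c : Module.Dual R N) (e : N)
    (hN : ∀ y, j (p y) + c y • e = y) (x : ExteriorAlgebra R N) :
    ExteriorAlgebra.map j (ExteriorAlgebra.map p x) + ExteriorAlgebra.ι R e *
      ExteriorAlgebra.map j (ExteriorAlgebra.map p (koszulD c x)) = x := by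
  induction x using CliffordAlgebra.left_induction with
  | algebraMap a =>
    erw [koszulD_algebraMap, AlgHom.commutes, AlgHom.commutes]
    rw [map_zero, map_zero, mul_zero, add_zero]
  | add x y hx hy =>
    conv_rhs => rw [← hx, ← hy]
    simp only [map_add, mul_add]
    abel
  | ι_mul x m ih =>
    change ExteriorAlgebra.map j (ExteriorAlgebra.map p (ExteriorAlgebra.ι R m * x)) +
      ExteriorAlgebra.ι R e * ExteriorAlgebra.map j (ExteriorAlgebra.map p
        (koszulD c (ExteriorAlgebra.ι R m * x))) = ExteriorAlgebra.ι R m * x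
    rw [koszulD_ι_mul]
    simp only [map_mul, map_sub, map_smul, ExteriorAlgebra.map_apply_ι]
    set X := ExteriorAlgebra.map j (ExteriorAlgebra.map p x)
    set Y := ExteriorAlgebra.map j (ExteriorAlgebra.map p (koszulD c x))
    have hm : ExteriorAlgebra.ι R m = ExteriorAlgebra.ι R (j (p m)) +
        c m • ExteriorAlgebra.ι R e := by
      rw [← map_smul, ← map_add, hN]
    -- Since `e` anticommutes with vectors and has square zero, expanding `m = j (p m) + c m • e`
    -- leaves only the desired terms.
    have h1 : ExteriorAlgebra.ι R e * (ExteriorAlgebra.ι R (j (p m)) * Y) =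
        - (ExteriorAlgebra.ι R (j (p m)) * (ExteriorAlgebra.ι R e * Y)) := by
      rw [← mul_assoc, ← mul_assoc, ← neg_mul, eq_neg_of_add_eq_zero_left
        (ExteriorAlgebra.ι_add_mul_swap e (j (p m)))]
    have h2 : ExteriorAlgebra.ι R e * (ExteriorAlgebra.ι R e * Y) = 0 := by
      rw [← mul_assoc, ExteriorAlgebra.ι_sq_zero, zero_mul]
    conv_rhs => rw [← ih, hm]
    rw [mul_sub, h1, add_mul, mul_add, mul_add, smul_mul_assoc, smul_mul_assoc, h2, mul_smul_comm]
    simp only [smul_zero]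
    abel

theorem exists_koszulD_eq_of_algebraMap (f : Module.Dual R M) {b : R}
    (hb : b ∈ LinearMap.range f) :
    ∃ y ∈ ⋀[R]^1 M, koszulD f y = algebraMap R _ b := by
  obtain ⟨m, rfl⟩ := hb
  exact ⟨ExteriorAlgebra.ι R m, by simp [ExteriorAlgebra.exteriorPower], koszulD_ι f m⟩

theorem algebraMap_mem_of_koszulD (f : Module.Dual R M) {y : ExteriorAlgebra R M} {b : R}
    (hy : y ∈ ⋀[R]^1 M) (h : koszulD f y = algebraMap R _ b) : b ∈ LinearMap.range f := by
  rw [ExteriorAlgebra.exteriorPower, pow_one] at hy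
  obtain ⟨m, rfl⟩ := hy
  rw [koszulD_ι] at h
  exact ⟨m, (ExteriorAlgebra.algebraMap_leftInverse M).injective h⟩

/-- Exactness of the Koszul complex of a linear form in positive degrees. -/
def KoszulExact (f : Module.Dual R M) : Prop :=
  ∀ k, ∀ x ∈ ⋀[R]^(k + 1) M, koszulD f x = 0 → ∃ y ∈ ⋀[R]^(k + 2) M, koszulD f y = x

/-- Adjoining a nonzerodivisor modulo the ideal preserves exactness of the Koszul complex. -/
theorem KoszulExact.extend {f : Module.Dual R M} (hf : KoszulExact f) (j : M →ₗ[R] N)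
    (p : N →ₗ[R] M) (c : Module.Dual R N) (e : N) (hN : ∀ y, j (p y) + c y • e = y)
    (hpj : p ∘ₗ j = LinearMap.id) (hcj : c ∘ₗ j = 0) (hce : c e = 1) (g : Module.Dual R N)
    (hg : g ∘ₗ j = f) (hreg : ∀ b, g e * b ∈ LinearMap.range f → b ∈ LinearMap.range f) :
    KoszulExact g := by
  intro k x hx hdx
  have hpe : p e = 0 := by
    have h1 := congrArg p (hN e)
    rw [hce, one_smul, map_add] at h1
    have h2 := LinearMap.congr_fun hpj (p e)
    simp only [LinearMap.comp_apply, LinearMap.id_apply] at h2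
    rw [h2] at h1
    simpa using h1
  have hret : ∀ z : ExteriorAlgebra R M, ExteriorAlgebra.map p (ExteriorAlgebra.map j z) = z := by
    intro z
    rw [← AlgHom.comp_apply, ExteriorAlgebra.map_comp_map, hpj, ExteriorAlgebra.map_id]
    rfl
  set a := ExteriorAlgebra.map p x with ha
  set b := ExteriorAlgebra.map p (koszulD c x) with hb
  have hx' : ExteriorAlgebra.map j a + ExteriorAlgebra.ι R e * ExteriorAlgebra.map j b = x :=
    map_map_add_ι_mul j p c e hN x
  have ha_mem : a ∈ ⋀[R]^(k + 1) M := map_mem_exteriorPower p hx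
  have hb_mem : b ∈ ⋀[R]^k M := map_mem_exteriorPower p (koszulD_mem c hx)
  -- the differential of `x` in terms of `a` and `b`
  have hd : ∀ u v : ExteriorAlgebra R M, koszulD g (ExteriorAlgebra.map j u +
      ExteriorAlgebra.ι R e * ExteriorAlgebra.map j v) =
      ExteriorAlgebra.map j (koszulD f u + g e • v) -
        ExteriorAlgebra.ι R e * ExteriorAlgebra.map j (koszulD f v) := by
    intro u v
    rw [map_add, koszulD_ι_mul, koszulD_map, koszulD_map, hg, map_add, map_smul]
    abel
  rw [← hx', hd] at hdx
  have h1 : koszulD f a + g e • b = 0 := by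
    have := congrArg (ExteriorAlgebra.map p) hdx
    rw [map_sub, map_mul, ExteriorAlgebra.map_apply_ι, hpe, map_zero, zero_mul, sub_zero, hret,
      map_zero] at this
    exact this
  -- What remains of `hdx` is that `e` times the image of `koszulD f b` vanishes. Contraction with
  -- `c` strips off `e`, and `p` undoes `j`.
  have h2 : koszulD f b = 0 := by
    rw [h1, map_zero, zero_sub, neg_eq_zero] at hdx
    have := congrArg (fun z => ExteriorAlgebra.map p (koszulD c z)) hdx
    simp only [koszulD_ι_mul, hce, one_smul, koszulD_map, hcj, map_zero, map_sub, map_mul,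
      ExteriorAlgebra.map_apply_ι, hpe, zero_mul, sub_zero, hret] at this
    exact this
  -- In positive degree the cycle `b` is a boundary by hypothesis. In degree zero it is a scalar
  -- `β`, and `h1` puts `g e * β` in the range of `f`; this is where the nonzerodivisor condition is
  -- needed.
  obtain ⟨b', hb'_mem, hb'⟩ : ∃ b' ∈ ⋀[R]^(k + 1) M, koszulD f b' = b := by
    rcases k with _ | k
    · obtain ⟨β, hβ⟩ := Submodule.mem_one.1 hb_mem
      rw [← hβ] at h1 ⊢
      refine exists_koszulD_eq_of_algebraMap f (hreg β ?_)
      rw [← neg_mem_iff]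
      refine algebraMap_mem_of_koszulD f ha_mem ?_
      rw [eq_neg_of_add_eq_zero_left h1, map_neg, map_mul, Algebra.smul_def]
    · exact hf k b hb_mem h2
  -- By `h1`, the correction by `g e • b'` makes `a` a cycle. The minus sign of `b'` in the witness
  -- below compensates the sign in `hd`.
  obtain ⟨a', ha'_mem, ha'⟩ := hf k (a + g e • b')
    (add_mem ha_mem (Submodule.smul_mem _ _ hb'_mem)) (by rw [map_add, map_smul, hb', h1])
  refine ⟨ExteriorAlgebra.map j a' + ExteriorAlgebra.ι R e * ExteriorAlgebra.map j (-b'),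
    add_mem (map_mem_exteriorPower j ha'_mem)
      (ι_mul_mem e (map_mem_exteriorPower j (neg_mem hb'_mem))), ?_⟩
  rw [hd, ha', map_neg, hb', ← hx']
  simp

theorem koszulExact_of_subsingleton [Subsingleton M] (f : Module.Dual R M) : KoszulExact f := by
  intro k x hx _
  refine ⟨0, zero_mem _, ?_⟩
  rw [map_zero]
  have : LinearMap.range (ExteriorAlgebra.ι R (M := M)) = ⊥ := by
    rw [LinearMap.range_eq_bot]; exact Subsingleton.elim _ _
  rw [ExteriorAlgebra.exteriorPower, this, pow_succ, Submodule.mul_bot] at hx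
  exact ((Submodule.mem_bot R).1 hx).symm

/-- The linear form on `R^n` with values `r_i`. -/
noncomputable def seqForm {n : ℕ} (r : Fin n → R) : Module.Dual R (Fin n → R) :=
  Fintype.linearCombination R r

theorem range_seqForm {n : ℕ} (r : Fin n → R) :
    LinearMap.range (seqForm r) = Ideal.span (Set.range r) :=
  Fintype.range_linearCombination R r

/-- Induction on the length, splitting off the last coordinate. The range of the truncated form is
the ideal of the earlier elements, so regularity of the last element is what `KoszulExact.extend`
requires. -/
theorem koszulExact_seqForm {n : ℕ} (r : Fin n → R)
    (hr : ∀ (i : Fin n) (b : R), r i * b ∈ Ideal.span (r '' {j | j < i}) →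
      b ∈ Ideal.span (r '' {j | j < i})) : KoszulExact (seqForm r) := by
  induction n with
  | zero => exact koszulExact_of_subsingleton _
  | succ n ih =>
    have himg : ∀ i : Fin n, r '' {j | j < i.castSucc} =
        (fun l => r (Fin.castSucc l)) '' {j | j < i} := by
      intro i
      ext z
      constructor
      · rintro ⟨l, hl, rfl⟩
        have hl' : l < i.castSucc := hl
        exact ⟨l.castLT (by have := i.2; have : (l : ℕ) < i := hl'; omega),
          by have : (l : ℕ) < i := hl'; exact this, by simp⟩
      · rintro ⟨l, hl, rfl⟩
        exact ⟨l.castSucc, Fin.castSucc_lt_castSucc_iff.2 hl, rfl⟩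
    have hlast : r '' {j | j < Fin.last n} = Set.range (fun l => r (Fin.castSucc l)) := by
      ext z
      constructor
      · rintro ⟨l, hl, rfl⟩
        exact ⟨l.castLT hl, by simp⟩
      · rintro ⟨l, rfl⟩
        exact ⟨l.castSucc, Fin.castSucc_lt_last l, rfl⟩
    -- Here `p` drops the last coordinate and `j` appends a zero; the complement is spanned by the
    -- last basis vector.
    let p : (Fin (n + 1) → R) →ₗ[R] (Fin n → R) := LinearMap.funLeft R R Fin.castSucc
    let j : (Fin n → R) →ₗ[R] (Fin (n + 1) → R) :=
      { toFun := fun v => Fin.snoc v 0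
        map_add' := fun v w => by
          ext l
          induction l using Fin.lastCases <;> simp
        map_smul' := fun a v => by
          ext l
          induction l using Fin.lastCases <;> simp }
    have hj : ∀ v, j v = Fin.snoc v 0 := fun _ => rfl
    refine (ih (fun l => r l.castSucc) fun i b hb => ?_).extend j p
      (LinearMap.proj (Fin.last n)) (Pi.single (Fin.last n) 1) ?_ ?_ ?_ ?_ _ ?_ ?_
    · rw [← himg] at hb ⊢
      exact hr _ b hb
    · intro y
      ext l
      induction l using Fin.lastCases with
      | last => simp [hj]
      | cast l => simp [hj, p]
    · ext v l
      simp [hj, p]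
    · ext v
      simp [hj]
    · simp
    · ext v
      simp [hj, seqForm, Fintype.linearCombination_apply, Fin.sum_univ_castSucc]
    · intro b hb
      rw [range_seqForm, ← hlast] at hb ⊢
      refine hr _ b ?_
      simpa [seqForm, Fintype.linearCombination_apply_single] using hb

end Koszul

/-! ### Regular sequences are quasi-regular -/

section QuasiRegular

open MvPolynomial

variable {R : Type*} [CommRing R] {σ : Type*}

/-- A product `c * z` with `c ∈ J` is the value of `c` times a form with value `z`, and such
products generate. -/
theorem exists_isHomogeneous_coeff_mem (x : σ → R) (J : Ideal R) {s : ℕ} {y : R}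
    (hy : y ∈ J * Ideal.span (Set.range x) ^ s) :
    ∃ G : MvPolynomial σ R, G.IsHomogeneous s ∧ (∀ d, coeff d G ∈ J) ∧ eval x G = y := by
  induction hy using Submodule.mul_induction_on' with
  | mem_mul_mem c hc z hz =>
    obtain ⟨H, hH, rfl⟩ := (Ideal.mem_span_pow_iff_exists_isHomogeneous x z).1 hz
    refine ⟨C c * H, by simpa using (isHomogeneous_C σ c).mul hH, fun d => ?_, by simp⟩
    rw [coeff_C_mul]
    exact J.mul_mem_right _ hc
  | add y _ z _ hy hz =>
    obtain ⟨G, hG, hG', rfl⟩ := hy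
    obtain ⟨H, hH, hH', rfl⟩ := hz
    exact ⟨G + H, hG.add hH, fun d => by rw [coeff_add]; exact add_mem (hG' d) (hH' d), by simp⟩

/-- The coefficients of homogeneous relations of degree `s` between the `x i`, `i ∈ T`, lie in the
ideal generated by `x`. -/
def QuasiRegularAt (T : Set σ) (x : σ → R) (s : ℕ) : Prop :=
  ∀ F : MvPolynomial σ R, F.IsHomogeneous s → eval x F = 0 →
    ∀ d : σ →₀ ℕ, (∀ i ∉ T, d i = 0) → coeff d F ∈ Ideal.span (Set.range x)

/-- A value in the next power of the ideal is also the value of a form of degree `s` with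
coefficients in the ideal. Subtracting that form gives an exact relation without changing the
coefficients modulo the ideal. -/
theorem QuasiRegularAt.coeff_mem {T : Set σ} {x : σ → R} {s : ℕ} (h : QuasiRegularAt T x s)
    {F : MvPolynomial σ R} (hF : F.IsHomogeneous s)
    (hFx : eval x F ∈ Ideal.span (Set.range x) ^ (s + 1)) (d : σ →₀ ℕ) (hd : ∀ i ∉ T, d i = 0) :
    coeff d F ∈ Ideal.span (Set.range x) := by
  rw [pow_succ'] at hFx
  obtain ⟨G, hG, hGJ, hGx⟩ := exists_isHomogeneous_coeff_mem x _ hFx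
  have := h (F - G) (hF.sub hG) (by rw [map_sub, hGx, sub_self]) d hd
  rw [coeff_sub] at this
  simpa using add_mem this (hGJ d)

/-- Monomials with a variable outside `T` evaluate to zero; each other term is an element of the
ideal times a monomial of degree `s` in the generators. -/
theorem eval_mem_pow_succ {T : Set σ} {x : σ → R} (hx : ∀ i ∉ T, x i = 0) {s : ℕ}
    {F : MvPolynomial σ R} (hF : F.IsHomogeneous s)
    (h : ∀ d : σ →₀ ℕ, (∀ i ∉ T, d i = 0) → coeff d F ∈ Ideal.span (Set.range x)) :
    eval x F ∈ Ideal.span (Set.range x) ^ (s + 1) := by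
  rw [eval_eq]
  refine sum_mem fun d hd => ?_
  by_cases hdT : ∀ i ∉ T, d i = 0
  · rw [pow_succ']
    refine Ideal.mul_mem_mul (h d hdT) ?_
    refine (Ideal.mem_span_pow_iff_exists_isHomogeneous x _).2 ⟨monomial d 1,
      isHomogeneous_monomial _ ?_, ?_⟩
    · have := hF (mem_support_iff.1 hd)
      rwa [Finsupp.degree_eq_weight_one]
    · simp [eval_monomial, Finsupp.prod]
  · push Not at hdT
    obtain ⟨i, hi, hdi⟩ := hdT
    rw [Finset.prod_eq_zero (Finsupp.mem_support_iff.2 hdi) (by rw [hx i hi, zero_pow hdi]),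
      mul_zero]
    exact zero_mem _

/-- A nonzerodivisor modulo J is one modulo every J^s. If `w` is the value of a form `G` of degree
`s` and `a * w` lies in J^(s+1), quasi-regularity puts the coefficients of `a G` in J, hence those
of `G`, so `w` lies in J^(s+1). -/
theorem mem_pow_of_mul_mem_pow {T : Set σ} {x : σ → R} (hx : ∀ i ∉ T, x i = 0)
    (h : ∀ s, QuasiRegularAt T x s) {a : R}
    (ha : ∀ b, a * b ∈ Ideal.span (Set.range x) → b ∈ Ideal.span (Set.range x)) (s : ℕ) {w : R}
    (hw : a * w ∈ Ideal.span (Set.range x) ^ s) : w ∈ Ideal.span (Set.range x) ^ s := by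
  induction s with
  | zero => simp
  | succ s ih =>
    obtain ⟨G, hG, rfl⟩ := (Ideal.mem_span_pow_iff_exists_isHomogeneous x w).1
      (ih (Ideal.pow_le_pow_right (Nat.le_succ s) hw))
    refine eval_mem_pow_succ hx hG fun d hd => ha _ ?_
    rw [← coeff_C_mul]
    exact (h s).coeff_mem (by simpa using (isHomogeneous_C σ a).mul hG)
      (by rwa [map_mul, eval_C]) d hd

theorem isHomogeneous_divMonomial {F : MvPolynomial σ R} {s : ℕ} (hF : F.IsHomogeneous (s + 1))
    (t : σ) : (F.divMonomial (Finsupp.single t 1)).IsHomogeneous s := by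
  intro d hd
  rw [coeff_divMonomial] at hd
  have := hF hd
  rw [map_add, Finsupp.weight_single] at this
  simp only [Pi.one_apply, smul_eq_mul, mul_one] at this
  change Finsupp.weight 1 d = s
  omega

theorem isHomogeneous_modMonomial {F : MvPolynomial σ R} {s : ℕ} (hF : F.IsHomogeneous s)
    (t : σ →₀ ℕ) : (F.modMonomial t).IsHomogeneous s := by
  intro d hd
  by_cases h : t ≤ d
  · exact absurd (coeff_modMonomial_of_le F h) hd
  · rw [coeff_modMonomial_of_not_le F h] at hd
    exact hF hd

theorem single_le_iff_ne_zero (t : σ) (d : σ →₀ ℕ) : Finsupp.single t 1 ≤ d ↔ d t ≠ 0 := by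
  rw [Finsupp.single_le_iff]; omega

/-- Induction on the degree. Write F = X_t H + G with G free of X_t. A relation F = 0 gives a · H(x,
a) = -G(x), so the value of H lies in a high power of the old ideal. This controls the coefficients
of H by induction, and those of G by quasi-regularity of `x`. -/
theorem QuasiRegularAt.insert [DecidableEq σ] {T : Set σ} {x : σ → R} {t : σ} (ht : t ∉ T)
    (hx : ∀ i ∉ T, x i = 0) (h : ∀ s, QuasiRegularAt T x s) {a : R}
    (ha : ∀ b, a * b ∈ Ideal.span (Set.range x) → b ∈ Ideal.span (Set.range x)) (s : ℕ) :
    QuasiRegularAt (insert t T) (Function.update x t a) s := by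
  have hJ : Ideal.span (Set.range x) ≤ Ideal.span (Set.range (Function.update x t a)) := by
    rw [Ideal.span_le]
    rintro _ ⟨i, rfl⟩
    by_cases hi : i = t
    · rw [hi, hx t ht]; exact zero_mem _
    · exact Ideal.subset_span ⟨i, Function.update_of_ne hi _ _⟩
  have haJ : a ∈ Ideal.span (Set.range (Function.update x t a)) :=
    Ideal.subset_span ⟨t, Function.update_self _ _ _⟩
  induction s with
  | zero =>
    intro F hF hFx d _
    rw [totalDegree_eq_zero_iff_eq_C.1 ((totalDegree_zero_iff_isHomogeneous _).2 hF)] at hFx ⊢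
    rw [eval_C] at hFx
    rw [hFx]
    simp
  | succ s ih =>
    intro F hF hFx d hd
    set H := F.divMonomial (Finsupp.single t 1) with hH
    set G := F.modMonomial (Finsupp.single t 1) with hG
    have hFGH : X t * H + G = F := divMonomial_add_modMonomial_single F t
    have hHs : H.IsHomogeneous s := isHomogeneous_divMonomial hF t
    have hGs : G.IsHomogeneous (s + 1) := isHomogeneous_modMonomial hF _
    -- `G` does not involve the variable `t`, so the new value at `t` plays no role.
    have hGx : eval (Function.update x t a) G = eval x G := by
      rw [eval_eq, eval_eq]
      refine Finset.sum_congr rfl fun e he => ?_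
      have het : e t = 0 := by
        by_contra het
        exact mem_support_iff.1 he (coeff_modMonomial_of_le F ((single_le_iff_ne_zero t e).2 het))
      congr 1
      refine Finset.prod_congr rfl fun i hi => ?_
      rw [Function.update_of_ne]
      rintro rfl
      exact Finsupp.mem_support_iff.1 hi het
    rw [← hFGH, map_add, map_mul, eval_X, Function.update_self, hGx] at hFx
    have hHx : eval (Function.update x t a) H ∈ Ideal.span (Set.range x) ^ (s + 1) := by
      refine mem_pow_of_mul_mem_pow hx h ha _ ?_
      rw [eq_neg_of_add_eq_zero_left hFx]
      exact neg_mem ((Ideal.mem_span_pow_iff_exists_isHomogeneous x _).2 ⟨G, hGs, rfl⟩)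
    by_cases hdt : d t = 0
    -- Replace the value of `H` by that of a form `k` of degree `s + 1` in the old sequence: then `G
    -- + a k` is a relation between the old elements. The correction `a k` has coefficients in the
    -- new ideal because `a` does.
    · obtain ⟨k, hk, hkx⟩ := (Ideal.mem_span_pow_iff_exists_isHomogeneous x _).1 hHx
      have h1 := h (s + 1) (G + C a * k)
        (hGs.add (by simpa using (isHomogeneous_C σ a).mul hk))
        (by rw [map_add, map_mul, eval_C, hkx, add_comm, hFx]) d (fun i hi => by
          by_cases hit : i = t
          · rw [hit, hdt]
          · exact hd i (by simp [hit, hi]))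
      have h2 : coeff d F = coeff d (G + C a * k) - a * coeff d k := by
        rw [coeff_add, coeff_C_mul, add_sub_cancel_right, hG,
          coeff_modMonomial_of_not_le F (by rw [single_le_iff_ne_zero]; simpa using hdt)]
      rw [h2]
      exact sub_mem (hJ h1) (Ideal.mul_mem_right _ _ haJ)
    -- Monomials divisible by X_t have their coefficients from `H`, which has degree `s`; its value
    -- lies in the power `s + 1` of the new ideal, so the induction hypothesis applies modulo that
    -- power.
    · have h1 := ih.coeff_mem hHs (Ideal.pow_right_mono hJ _ hHx) (d - Finsupp.single t 1)
        (fun i hi => by simp [hd i hi])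
      rw [hH, coeff_divMonomial, add_tsub_cancel_of_le ((single_le_iff_ne_zero t d).2 hdt)] at h1
      exact h1

/-- Only the constant monomial is supported in the empty set, and its coefficient is the value at
zero. -/
theorem quasiRegularAt_empty (s : ℕ) : QuasiRegularAt ∅ (0 : σ → R) s := by
  intro F hF hFx d hd
  obtain rfl : d = 0 := Finsupp.ext fun i => hd i (by simp)
  have : eval (0 : σ → R) F = coeff 0 F := by rw [eval_zero, constantCoeff_eq]
  rw [← this, hFx]
  exact zero_mem _

/-- A regular sequence is quasi-regular. -/
theorem quasiRegularAt_univ {n : ℕ} (r : Fin n → R)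
    (hr : ∀ (i : Fin n) (b : R), r i * b ∈ Ideal.span (r '' {j | j < i}) →
      b ∈ Ideal.span (r '' {j | j < i})) (s : ℕ) : QuasiRegularAt Set.univ r s := by
  have hspan : ∀ m : ℕ, Ideal.span (Set.range fun i : Fin n => if (i : ℕ) < m then r i else 0) =
      Ideal.span (r '' {j : Fin n | (j : ℕ) < m}) := by
    intro m
    apply le_antisymm
    · rw [Ideal.span_le]
      rintro _ ⟨i, rfl⟩
      dsimp only
      split_ifs with hi
      · exact Ideal.subset_span ⟨i, hi, rfl⟩
      · exact zero_mem _
    · refine Ideal.span_mono ?_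
      rintro _ ⟨i, hi, rfl⟩
      exact ⟨i, if_pos hi⟩
  -- The elements are switched on one at a time, with zeros in the remaining places, so that the
  -- polynomial ring stays fixed throughout.
  have key : ∀ m : ℕ, m ≤ n → ∀ s, QuasiRegularAt {i : Fin n | (i : ℕ) < m}
      (fun i => if (i : ℕ) < m then r i else 0) s := by
    intro m
    induction m with
    | zero =>
      intro _ s
      simpa using! quasiRegularAt_empty (R := R) (σ := Fin n) s
    | succ m ih =>
      intro hm s
      let t : Fin n := ⟨m, hm⟩
      have hT : {i : Fin n | (i : ℕ) < m + 1} = insert t {i : Fin n | (i : ℕ) < m} := by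
        ext i
        simp only [Set.mem_ofPred_eq, Set.mem_insert_iff, Fin.ext_iff, t]
        omega
      have hu : (fun i : Fin n => if (i : ℕ) < m + 1 then r i else 0) =
          Function.update (fun i : Fin n => if (i : ℕ) < m then r i else 0) t (r t) := by
        ext i
        by_cases hi : i = t
        · subst hi; simp [t]
        · rw [Function.update_of_ne hi]
          have : (i : ℕ) ≠ m := fun h => hi (Fin.ext h)
          have : (i : ℕ) < m + 1 ↔ (i : ℕ) < m := by omega
          simp [this]
      rw [hT, hu]
      refine QuasiRegularAt.insert (by simp [t]) (fun i hi => if_neg hi) (ih (by omega)) ?_ s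
      have h := hspan m
      exact fun b => h ▸ hr t b
  have := key n le_rfl s
  simpa using this

end QuasiRegular

/-! ### Forms and the associated graded ring -/

section SymToGr

open MvPolynomial

variable {R : Type u} [CommRing R] {n : ℕ}

/-- The surjection from forms of degree `s` to `I^s / I^(s+1)` sending `x_i` to `r_i`. -/
noncomputable def symToGr (r : Fin n → R) {I : Ideal R} (hI : I = Ideal.span (Set.range r))
    (s : ℕ) : homogeneousSubmodule (Fin n) R s →ₗ[R] Gr I s :=
  (Submodule.mkQ _).comp ((aeval r).toLinearMap.restrict (p := homogeneousSubmodule (Fin n) R s)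
    (q := I ^ s) fun F hF => by
      rw [hI]; exact (Ideal.mem_span_pow_iff_exists_isHomogeneous r _).2 ⟨F, hF, rfl⟩)

variable (r : Fin n → R) {I : Ideal R} (hI : I = Ideal.span (Set.range r))

theorem symToGr_apply (s : ℕ) (F : homogeneousSubmodule (Fin n) R s) :
    symToGr r hI s F = Submodule.Quotient.mk ⟨eval r F, by
      rw [hI]; exact (Ideal.mem_span_pow_iff_exists_isHomogeneous r _).2 ⟨F, F.2, rfl⟩⟩ := rfl

theorem symToGr_surjective (s : ℕ) : Function.Surjective (symToGr r hI s) := by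
  intro y
  induction y using Submodule.Quotient.induction_on with | _ y =>
  obtain ⟨F, hF, hFy⟩ := (Ideal.mem_span_pow_iff_exists_isHomogeneous r (y : R)).1
    (by rw [← hI]; exact y.2)
  exact ⟨⟨F, hF⟩, congrArg Submodule.Quotient.mk (Subtype.ext hFy)⟩

theorem mem_smul_top_of_coeff_mem {s : ℕ} (F : homogeneousSubmodule (Fin n) R s)
    (h : ∀ d, coeff d (F : MvPolynomial (Fin n) R) ∈ I) :
    F ∈ I • (⊤ : Submodule R (homogeneousSubmodule (Fin n) R s)) := by
  classical
  have hF : F = ∑ d ∈ (F : MvPolynomial (Fin n) R).support.attach,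
      coeff d (F : MvPolynomial (Fin n) R) • (⟨monomial d 1, isHomogeneous_monomial _ (by
        have := F.2 (mem_support_iff.1 d.2)
        rwa [Finsupp.degree_eq_weight_one])⟩ : homogeneousSubmodule (Fin n) R s) := by
    apply Subtype.ext
    rw [AddSubmonoidClass.coe_finsetSum]
    conv_lhs => rw [(F : MvPolynomial (Fin n) R).as_sum, ← Finset.sum_attach]
    refine Finset.sum_congr rfl fun d _ => ?_
    simp [smul_monomial]
  rw [hF]
  exact sum_mem fun d _ => Submodule.smul_mem_smul (h d) trivial

/-- Quasi-regularity in module form; this gives exactness of the Koszul resolution at its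
augmentation. -/
theorem mem_smul_top_of_symToGr_eq_zero (s : ℕ)
    (hr : ∀ (i : Fin n) (b : R), r i * b ∈ Ideal.span (r '' {j | j < i}) →
      b ∈ Ideal.span (r '' {j | j < i}))
    (F : homogeneousSubmodule (Fin n) R s) (h : symToGr r hI s F = 0) :
    F ∈ I • (⊤ : Submodule R (homogeneousSubmodule (Fin n) R s)) := by
  refine mem_smul_top_of_coeff_mem F fun d => ?_
  rw [symToGr_apply, Submodule.Quotient.mk_eq_zero] at h
  have h' : eval r (F : MvPolynomial (Fin n) R) ∈ I ^ (s + 1) := h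
  rw [hI] at h' ⊢
  exact (quasiRegularAt_univ r hr s).coeff_mem F.2 h' d (by simp)

/-- Regularity of the sequence `r` in terms of ideals. -/
theorem isRegular_mem_of_mul_mem (hr : RingTheory.Sequence.IsRegular R (List.ofFn r)) (i : Fin n)
    (b : R) (hb : r i * b ∈ Ideal.span (r '' {j | j < i})) :
    b ∈ Ideal.span (r '' {j | j < i}) := by
  have h := hr.toIsWeaklyRegular.regular_mod_prev i (by simp)
  have hs : (Ideal.ofList ((List.ofFn r).take i) • ⊤ : Submodule R R) =
      Ideal.span (r '' {j | j < i}) := by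
    rw [smul_eq_mul, Ideal.mul_top, Ideal.ofList]
    congr 1
    ext z
    simp only [List.mem_take_iff_getElem, List.getElem_ofFn, Set.mem_ofPred_eq, Set.mem_image]
    constructor
    · rintro ⟨l, hl, rfl⟩
      rw [List.length_ofFn] at hl
      exact ⟨⟨l, by omega⟩, by rw [Fin.lt_def]; dsimp only; omega, rfl⟩
    · rintro ⟨l, hl, rfl⟩
      exact ⟨l, by rw [List.length_ofFn]; have : (l : ℕ) < i := hl; omega, rfl⟩
  rw [hs] at h
  rw [← Ideal.Quotient.eq_zero_iff_mem]
  apply h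
  change (List.ofFn r)[(i : ℕ)] • (Submodule.Quotient.mk b : R ⧸ Ideal.span (r '' {j | j < i})) =
    (List.ofFn r)[(i : ℕ)] • 0
  rw [smul_zero, ← Submodule.Quotient.mk_smul, Submodule.Quotient.mk_eq_zero]
  simpa using hb

end SymToGr

section

variable {R : Type u} [CommRing R]

/-! ### Homology as cycles modulo boundaries -/

section HomologyComparison

theorem hom_iCycles_mem_ker (K : ChainComplex (ModuleCat.{u} R) ℕ) (i : ℕ) (z : K.cycles i) :
    (K.iCycles i).hom z ∈ LinearMap.ker (K.d i (i - 1)).hom := by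
  rw [LinearMap.mem_ker, ← LinearMap.comp_apply, ← ModuleCat.hom_comp, K.iCycles_d]
  rfl

/-- The isomorphisms composing `homologyEquiv` all respect the inclusion of cycles, so it can be
evaluated on the class of a cycle. -/
theorem homologyEquiv_homologyπ (K : ChainComplex (ModuleCat.{u} R) ℕ) (i : ℕ) (z : K.cycles i) :
    homologyEquiv K i ((K.homologyπ i).hom z) =
      Submodule.Quotient.mk ⟨(K.iCycles i).hom z, hom_iCycles_mem_ker K i z⟩ := by
  have hi : (ComplexShape.down ℕ).prev i = i + 1 := by simp
  have hk : (ComplexShape.down ℕ).next i = i - 1 := by cases i <;> simp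
  have h : K.homologyπ i ≫ (ShortComplex.homologyMapIso (K.isoSc' (i + 1) i (i - 1) hi hk) ≪≫
      (K.sc' (i + 1) i (i - 1)).moduleCatHomologyIso).hom =
      ((K.cyclesIsoSc' (i + 1) i (i - 1) hi hk).hom ≫
        (K.sc' (i + 1) i (i - 1)).moduleCatCyclesIso.hom) ≫
        (K.sc' (i + 1) i (i - 1)).moduleCatLeftHomologyData.π := by
    rw [Iso.trans_hom, Category.assoc, ← ShortComplex.π_moduleCatCyclesIso_hom]
    exact K.π_homologyIsoSc'_hom_assoc (i + 1) i (i - 1) hi hk _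
  have h2 : ((K.cyclesIsoSc' (i + 1) i (i - 1) hi hk).hom ≫
      (K.sc' (i + 1) i (i - 1)).moduleCatCyclesIso.hom) ≫
      (K.sc' (i + 1) i (i - 1)).moduleCatLeftHomologyData.i = K.iCycles i := by
    rw [Category.assoc, ShortComplex.moduleCatCyclesIso_hom_i]
    exact K.cyclesIsoSc'_hom_iCycles (i + 1) i (i - 1) hi hk
  have e := congrArg (fun f => f.hom z) h
  have e2 := congrArg (fun f => f.hom z) h2
  have hq : LinearMap.range (K.sc' (i + 1) i (i - 1)).moduleCatToCycles =
      (LinearMap.range (K.d (i + 1) i).hom).submoduleOf (LinearMap.ker (K.d i (i - 1)).hom) := by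
    ext x
    exact ⟨fun ⟨y, hy⟩ => ⟨y, congrArg Subtype.val hy⟩, fun ⟨y, hy⟩ => ⟨y, Subtype.ext hy⟩⟩
  refine (congrArg (Submodule.quotEquivOfEq _ _ hq) e).trans ?_
  exact congrArg Submodule.Quotient.mk (Subtype.ext e2)

/-- The map on cycles modulo boundaries induced by a chain map. -/
noncomputable def Homology.map {K L : ChainComplex (ModuleCat.{u} R) ℕ} (f : K ⟶ L) (i : ℕ) :
    Homology K i →ₗ[R] Homology L i :=
  Submodule.mapQ _ _ ((f.f i).hom.restrict fun x hx => by
      rw [LinearMap.mem_ker] at hx ⊢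
      rw [← LinearMap.comp_apply, ← ModuleCat.hom_comp, f.comm, ModuleCat.hom_comp,
        LinearMap.comp_apply, hx, map_zero])
    (by
      rintro ⟨x, hx⟩ ⟨y, hy⟩
      refine ⟨(f.f (i + 1)).hom y, ?_⟩
      rw [← LinearMap.comp_apply, ← ModuleCat.hom_comp, f.comm, ModuleCat.hom_comp,
        LinearMap.comp_apply, hy]
      rfl)

theorem homologyEquiv_homologyMap {K L : ChainComplex (ModuleCat.{u} R) ℕ} (f : K ⟶ L) (i : ℕ)
    (x : K.homology i) :
    homologyEquiv L i ((HomologicalComplex.homologyMap f i).hom x) =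
      Homology.map f i (homologyEquiv K i x) := by
  obtain ⟨z, rfl⟩ := (ModuleCat.epi_iff_surjective (K.homologyπ i)).1 inferInstance x
  have h := congrArg (fun g => g.hom z) (HomologicalComplex.homologyπ_naturality f i)
  have h2 := congrArg (fun g => g.hom z) (HomologicalComplex.cyclesMap_i f i)
  have h' : (HomologicalComplex.homologyMap f i).hom ((K.homologyπ i).hom z) =
    (L.homologyπ i).hom ((HomologicalComplex.cyclesMap f i).hom z) := h
  refine (congrArg _ h').trans ?_
  refine (homologyEquiv_homologyπ L i _).trans ?_
  refine Eq.trans ?_ (congrArg (Homology.map f i) (homologyEquiv_homologyπ K i z)).symm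
  exact congrArg Submodule.Quotient.mk (Subtype.ext h2)

/-- In degree zero every element is a cycle, and homology maps to the cokernel of the differential.
This form is needed to recognise Tor_0 as a tensor product. -/
theorem π_eq_homologyι_symm (K : ChainComplex (ModuleCat.{u} R) ℕ)
    (x : LinearMap.ker (K.d 0 (0 - 1)).hom) :
    (K.homologyι 0).hom ((homologyEquiv K 0).symm (Submodule.Quotient.mk x)) =
      (K.pOpcycles 0).hom x := by
  obtain ⟨y, hy⟩ := (homologyEquiv K 0).surjective (Submodule.Quotient.mk x)
  rw [← hy, LinearEquiv.symm_apply_apply]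
  obtain ⟨z, rfl⟩ := (ModuleCat.epi_iff_surjective (K.homologyπ 0)).1 inferInstance y
  have h1 := homologyEquiv_homologyπ K 0 z
  have h2 := h1.symm.trans hy
  rw [Submodule.Quotient.eq] at h2
  obtain ⟨w, hw⟩ := h2
  have hw' : (K.d 1 0).hom w = (K.iCycles 0).hom z - x := hw
  have h3 : (K.homologyι 0).hom ((K.homologyπ 0).hom z) = (K.pOpcycles 0).hom ((K.iCycles 0).hom z)
    := congrArg (fun g => g.hom z) (K.homology_π_ι 0)
  have h4 : (K.pOpcycles 0).hom ((K.d 1 0).hom w) = 0 :=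
    congrArg (fun g => g.hom w) (K.d_pOpcycles 1 0)
  rw [hw', map_sub, sub_eq_zero] at h4
  exact h3.trans h4

end HomologyComparison

/-! ### Change of resolution and the degree-zero part of Tor -/

section TorComparison

variable (I : Ideal R)

/-- The chain map `R/I ⊗ P → R/I ⊗ Q` induced by a chain map. -/
noncomputable abbrev tensorComplexMap {M N : ModuleCat.{u} R} {P : ProjectiveResolution M}
    {Q : ProjectiveResolution N} (f : P.complex ⟶ Q.complex) :
    tensorComplex I P ⟶ tensorComplex I Q :=
  (((tensoringLeft (ModuleCat.{u} R)).obj (ModuleCat.of R (R ⧸ I))).mapHomologicalComplex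
    (ComplexShape.down ℕ)).map f

/-- Naturality of the computation of derived functors, applied to a lift of the identity of `M`. -/
theorem torEquiv_apply_of_lift {M : ModuleCat.{u} R} (P Q : ProjectiveResolution M)
    (f : P.complex ⟶ Q.complex) (hf : f.f 0 ≫ Q.π.f 0 = P.π.f 0) (k : ℕ) (x : TorMod I M k) :
    torEquiv I Q k x = Homology.map (tensorComplexMap I f) k (torEquiv I P k x) := by
  have h := ProjectiveResolution.isoLeftDerivedObj_hom_naturality (𝟙 M) P Q f
    (hf.trans (Category.comp_id (P.π.f 0)).symm) ((tensoringLeft (ModuleCat.{u} R)).obj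
    (ModuleCat.of R (R ⧸ I))) k
  rw [CategoryTheory.Functor.map_id, Category.id_comp] at h
  have h' := congrArg (fun g => g.hom x) h
  refine (congrArg (homologyEquiv (tensorComplex I Q) k) h').trans ?_
  exact homologyEquiv_homologyMap (tensorComplexMap I f) k _

theorem exists_lift_id {M : ModuleCat.{u} R} (P Q : ProjectiveResolution M) :
    ∃ f : P.complex ⟶ Q.complex, f.f 0 ≫ Q.π.f 0 = P.π.f 0 :=
  ⟨ProjectiveResolution.lift (𝟙 M) P Q, 
    (ProjectiveResolution.lift_commutes_zero (𝟙 M) P Q).trans (Category.comp_id (P.π.f 0))⟩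

theorem tensorComplex_mem_ker_zero {M : ModuleCat.{u} R} (P : ProjectiveResolution M)
    (x : (R ⧸ I) ⊗[R] P.complex.X 0) :
    x ∈ LinearMap.ker ((tensorComplex I P).d 0 (0 - 1)).hom :=
  d_pred_zero (K := tensorComplex I P) x

/-- Both classes have image `1 ⊗ π x` under the isomorphism of Tor_0 with the tensor product. This
locates the unit of the algebra in an arbitrary resolution. -/
theorem torEquiv_torZero {M : ModuleCat.{u} R} (P : ProjectiveResolution M)
    (x : P.complex.X 0) :
    torEquiv I P 0 (torZero I ((P.π.f 0).hom x)) = Submodule.Quotient.mk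
      ⟨(1 : R ⧸ I) ⊗ₜ[R] x, tensorComplex_mem_ker_zero I P _⟩ := by
  let F := (tensoringLeft (ModuleCat.{u} R)).obj (ModuleCat.of R (R ⧸ I))
  set q : Homology (tensorComplex I P) 0 := Submodule.Quotient.mk
      ⟨(1 : R ⧸ I) ⊗ₜ[R] x, tensorComplex_mem_ker_zero I P _⟩ with hq
  suffices h : torZero I ((P.π.f 0).hom x) = (torEquiv I P 0).symm q from
    (LinearEquiv.eq_symm_apply _).1 h
  apply (F.leftDerivedZeroIsoSelf.app M).toLinearEquiv.injective
  have e1 : (F.fromLeftDerivedZero.app M).hom (torZero I ((P.π.f 0).hom x)) =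
      ((1 : R ⧸ I) ⊗ₜ[R] (P.π.f 0).hom x : (R ⧸ I) ⊗[R] M) :=
    congrArg (fun g => g.hom ((1 : R ⧸ I) ⊗ₜ[R] (P.π.f 0).hom x : (R ⧸ I) ⊗[R] M))
      (F.leftDerivedZeroIsoSelf_inv_hom_id_app M)
  have e2 : (P.isoLeftDerivedObj F 0).hom.hom ((torEquiv I P 0).symm q) =
      (homologyEquiv (tensorComplex I P) 0).symm q :=
    congrArg (fun g => g.hom ((homologyEquiv (tensorComplex I P) 0).symm q))
      (P.isoLeftDerivedObj F 0).inv_hom_id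
  have e3 : (P.fromLeftDerivedZero' F).hom (((tensorComplex I P).homologyι 0).hom
      ((P.isoLeftDerivedObj F 0).hom.hom ((torEquiv I P 0).symm q))) =
      ((1 : R ⧸ I) ⊗ₜ[R] (P.π.f 0).hom x : (R ⧸ I) ⊗[R] M) := by
    rw [e2]
    refine (congrArg (P.fromLeftDerivedZero' F).hom
      (π_eq_homologyι_symm (tensorComplex I P) _)).trans ?_
    exact congrArg (fun g => g.hom ((1 : R ⧸ I) ⊗ₜ[R] x))
      (P.pOpcycles_comp_fromLeftDerivedZero' F)
  exact e1.trans ((congrArg (fun g => g.hom ((torEquiv I P 0).symm q))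
    (P.fromLeftDerivedZero_eq F)).trans e3).symm

end TorComparison

/-! ### Independence of the product from resolutions and pairings -/

section Independence

variable {M N L : ModuleCat.{u} R} (P : ProjectiveResolution M)
    (Q : ProjectiveResolution N) (T : ProjectiveResolution L) (s : ℕ)

/-- A family of bilinear maps satisfying the Leibniz rule and lifting zero is null-homotopic. -/
theorem exists_bilinear_homotopy
    (D : ∀ i j k : ℕ, P.complex.X i →ₗ[R] Q.complex.X j →ₗ[R] T.complex.X k)
    (hD : ∀ i j k : ℕ, i + j = k + 1 → ∀ x y,
      (T.complex.d (k + 1) k).hom (D i j (k + 1) x y) = rhs P Q s (fun i j => D i j k) i j x y)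
    (h0 : ∀ x y, (T.π.f 0).hom (D 0 0 0 x y) = 0) :
    ∃ H : ∀ i j k : ℕ, P.complex.X i →ₗ[R] Q.complex.X j →ₗ[R] T.complex.X k,
      ∀ i j k, i + j = k → ∀ x y, (T.complex.d (k + 1) k).hom (H i j (k + 1) x y) =
        D i j k x y - rhs P Q s (fun i j => H i j k) i j x y := by
  have ex0 : ∀ z : T.complex.X 0, (T.π.f 0).hom z = 0 →
      z ∈ LinearMap.range (T.complex.d 1 0).hom := by
    intro z hz
    have e := (ShortComplex.moduleCat_exact_iff_range_eq_ker _).1 T.exact₀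
    have e' : LinearMap.range (T.complex.d 1 0).hom = LinearMap.ker (T.π.f 0).hom := e
    rw [e']; exact hz
  have ex : ∀ k, LinearMap.range (T.complex.d (k + 2) (k + 1)).hom =
      LinearMap.ker (T.complex.d (k + 1) k).hom := fun k =>
    (ShortComplex.moduleCat_exact_iff_range_eq_ker _).1 (T.exact_succ k)
  -- The homotopy is built by target degree. The obstruction `D - rhs m` consists of boundaries,
  -- which are lifted bilinearly because the terms are projective; it then remains to see that the
  -- next obstruction is a cycle, hence a boundary.
  have step : ∀ k (m : ∀ i j : ℕ, P.complex.X i →ₗ[R] Q.complex.X j →ₗ[R] T.complex.X k),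
      (∀ i j, i + j = k → ∀ x y, D i j k x y - rhs P Q s m i j x y ∈
        LinearMap.range (T.complex.d (k + 1) k).hom) →
      ∃ m' : ∀ i j : ℕ, P.complex.X i →ₗ[R] Q.complex.X j →ₗ[R] T.complex.X (k + 1),
        (∀ i j, i + j = k → ∀ x y, (T.complex.d (k + 1) k).hom (m' i j x y) =
          D i j k x y - rhs P Q s m i j x y) ∧
        (∀ i j, i + j = k + 1 → ∀ x y, D i j (k + 1) x y - rhs P Q s m' i j x y ∈
          LinearMap.range (T.complex.d (k + 2) (k + 1)).hom) := by
    intro k m hm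
    have key : ∀ i j, ∃ g : P.complex.X i →ₗ[R] Q.complex.X j →ₗ[R] T.complex.X (k + 1),
        i + j = k → ∀ x y, (T.complex.d (k + 1) k).hom (g x y) =
          D i j k x y - rhs P Q s m i j x y := by
      intro i j
      by_cases hij : i + j = k
      · have := projective_term P i
        have := projective_term Q j
        obtain ⟨g, hg⟩ := exists_bilinear_lift (D i j k - rhs P Q s m i j) _ (hm i j hij)
        exact ⟨g, fun _ => hg⟩
      · exact ⟨0, fun h => absurd h hij⟩
    choose m' hm' using key
    refine ⟨m', hm', fun i j hij x y => ?_⟩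
    rw [ex, LinearMap.mem_ker, map_sub, hD i j k hij, sub_eq_zero]
    have e : (T.complex.d (k + 1) k).hom (rhs P Q s m' i j x y) =
        rhs P Q s (fun i j => D i j k - rhs P Q s m i j) i j x y := by
      rw [rhs_apply, rhs_apply, map_add, map_zsmul]
      congr 1
      · rcases i with _ | i
        · rw [d_pred_zero]; simp
        · exact hm' i j (by omega) _ _
      · congr 1
        rcases j with _ | j
        · rw [d_pred_zero]; simp
        · exact hm' i j (by omega) _ _
    rw [e]
    -- Since `rhs` is the differential of the double complex of bilinear maps, applying it twice
    -- gives zero.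
    have e2 : rhs P Q s (fun i j => D i j k - rhs P Q s m i j) i j x y =
        rhs P Q s (fun i j => D i j k) i j x y - rhs P Q s (rhs P Q s m) i j x y := by
      simp only [rhs_apply, LinearMap.sub_apply, smul_sub, smul_add]
      abel
    rw [e2, rhs_rhs, sub_zero]
  let S : ℕ → Type u := fun k =>
    {m : ∀ i j : ℕ, P.complex.X i →ₗ[R] Q.complex.X j →ₗ[R] T.complex.X k //
      ∀ i j, i + j = k → ∀ x y, D i j k x y - rhs P Q s m i j x y ∈
        LinearMap.range (T.complex.d (k + 1) k).hom}
  choose step hstep hstep' using step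
  -- A homotopy raises the degree by one, so the maps into degree zero may be taken to be zero; the
  -- first obstruction is then `D 0 0 0`, which the augmentation kills.
  let F : ∀ k, S k := fun k => Nat.rec (motive := S) ⟨fun _ _ => 0, by
      intro i j hij x y
      obtain ⟨rfl, rfl⟩ : i = 0 ∧ j = 0 := Nat.add_eq_zero_iff.1 hij
      rw [rhs_apply]
      simpa using ex0 _ (h0 x y)⟩
    (fun k m => ⟨step k m.1 m.2, hstep' k m.1 m.2⟩) k
  exact ⟨fun i j k => (F k).1 i j, fun i j k hij x y => hstep k (F k).1 (F k).2 i j hij x y⟩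

/-- On cycles the terms of a homotopy that involve differentials of the arguments disappear, so the
two products differ by a boundary. -/
theorem tensor_homotopy {A X X' Y Y' Z W X₁ Y₁ V : Type u} [CommRing A] [Algebra R A]
    [AddCommGroup X] [Module R X] [AddCommGroup X'] [Module R X'] [AddCommGroup Y] [Module R Y]
    [AddCommGroup Y'] [Module R Y'] [AddCommGroup Z] [Module R Z] [AddCommGroup W] [Module R W]
    [AddCommGroup X₁] [Module R X₁] [AddCommGroup Y₁] [Module R Y₁] [AddCommGroup V] [Module R V]
    (dX : X →ₗ[R] X') (dY : Y →ₗ[R] Y') (d : W →ₗ[R] Z) (H : X →ₗ[R] Y →ₗ[R] W)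
    (H₁ : X' →ₗ[R] Y →ₗ[R] Z) (H₂ : X →ₗ[R] Y' →ₗ[R] Z) (ε : ℤ) (m : X →ₗ[R] Y →ₗ[R] V)
    (c : V →ₗ[R] Z) (f : X →ₗ[R] X₁) (g : Y →ₗ[R] Y₁) (m' : X₁ →ₗ[R] Y₁ →ₗ[R] Z)
    (h : ∀ x y, d (H x y) = c (m x y) - m' (f x) (g y) - (H₁ (dX x) y + ε • H₂ x (dY y)))
    (x : A ⊗[R] X) (y : A ⊗[R] Y) (hx : dX.lTensor A x = 0) (hy : dY.lTensor A y = 0) :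
    d.lTensor A (TensorProduct.map₂ (LinearMap.mul R A) H x y) =
      c.lTensor A (TensorProduct.map₂ (LinearMap.mul R A) m x y) -
        TensorProduct.map₂ (LinearMap.mul R A) m' (f.lTensor A x) (g.lTensor A y) := by
  -- The full identity is proved first: a cycle need not be a sum of pure tensors that are cycles,
  -- so induction on tensors cannot carry the cycle conditions.
  suffices key : d.lTensor A (TensorProduct.map₂ (LinearMap.mul R A) H x y) =
      c.lTensor A (TensorProduct.map₂ (LinearMap.mul R A) m x y) -
        TensorProduct.map₂ (LinearMap.mul R A) m' (f.lTensor A x) (g.lTensor A y) -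
      (TensorProduct.map₂ (LinearMap.mul R A) H₁ (dX.lTensor A x) y +
        ε • TensorProduct.map₂ (LinearMap.mul R A) H₂ x (dY.lTensor A y)) by
    rwa [hx, hy, map_zero, map_zero, LinearMap.zero_apply, smul_zero, add_zero, sub_zero] at key
  clear hx hy
  induction x with
  | zero => simp
  | add x x' hx hx' =>
    simp only [map_add, LinearMap.add_apply, hx, hx', smul_add]
    abel
  | tmul a x =>
    induction y with
    | zero => simp
    | add y y' hy hy' =>
      simp only [map_add, hy, hy', smul_add]
      abel
    | tmul b y =>
      simp [h, TensorProduct.tmul_add, TensorProduct.tmul_sub]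

variable {P Q T s} {P' : ProjectiveResolution M} {Q' : ProjectiveResolution N}
  {T' : ProjectiveResolution L} {β : M →ₗ[R] N →ₗ[R] L}

theorem chain_map_d {K K' : ChainComplex (ModuleCat.{u} R) ℕ} (f : K ⟶ K') (i j : ℕ) (x : K.X i) :
    (K'.d i j).hom ((f.f i).hom x) = (f.f j).hom ((K.d i j).hom x) := by
  rw [← LinearMap.comp_apply, ← ModuleCat.hom_comp, f.comm]; rfl

theorem lift_π {P P' : ProjectiveResolution M} {f : P.complex ⟶ P'.complex}
    (hf : f.f 0 ≫ P'.π.f 0 = P.π.f 0) (x : P.complex.X 0) :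
    (P'.π.f 0).hom ((f.f 0).hom x) = (P.π.f 0).hom x := by
  rw [← hf]; rfl

/-- The product on Tor does not depend on the resolutions, nor on the pairing. -/
theorem Pairing.torMul_eq (I : Ideal R) (φ : Pairing P Q T β s) (φ' : Pairing P' Q' T' β s)
    (i j : ℕ) : φ.torMul I i j = φ'.torMul I i j := by
  obtain ⟨f, hf⟩ := exists_lift_id P P'
  obtain ⟨g, hg⟩ := exists_lift_id Q Q'
  obtain ⟨h, hh⟩ := exists_lift_id T T'
  -- The lifts of the identities give two families over `β` with values in `T'`: `φ` followed by
  -- `h`, and `φ'` preceded by `f` and `g`. Their difference lifts zero.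
  obtain ⟨H, hH⟩ := exists_bilinear_homotopy P Q T' s
    (fun i j k => (φ.map i j k).compr₂ (h.f k).hom -
      (φ'.map i j k).compl₁₂ (f.f i).hom (g.f j).hom)
    (fun i j k hij x y => by
      simp only [LinearMap.sub_apply, LinearMap.compr₂_apply, LinearMap.compl₁₂_apply, rhs_apply,
        map_sub]
      rw [chain_map_d, φ.leibniz i j k hij, φ'.leibniz i j k hij, chain_map_d, chain_map_d,
        map_add, map_zsmul, smul_sub]
      abel)
    (fun x y => by
      simp only [LinearMap.sub_apply, LinearMap.compr₂_apply, LinearMap.compl₁₂_apply, map_sub]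
      rw [lift_π hh, φ.augmentation, φ'.augmentation, lift_π hf, lift_π hg]
      exact sub_self _)
  ext a b
  apply (torEquiv I T' (i + j)).injective
  have hl : torEquiv I T (i + j) (φ.torMul I i j a b) = _ := LinearEquiv.apply_symm_apply _ _
  have hr : torEquiv I T' (i + j) (φ'.torMul I i j a b) = _ := LinearEquiv.apply_symm_apply _ _
  rw [torEquiv_apply_of_lift I T T' h hh, hl, hr]
  simp only [LinearMap.compl₁₂_apply, LinearEquiv.coe_coe]
  rw [torEquiv_apply_of_lift I P P' f hf, torEquiv_apply_of_lift I Q Q' g hg]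
  generalize torEquiv I P i a = a
  generalize torEquiv I Q j b = b
  induction a using Submodule.Quotient.induction_on with | _ a =>
  induction b using Submodule.Quotient.induction_on with | _ b =>
  refine (Submodule.Quotient.eq _).2 ⟨TensorProduct.map₂ (LinearMap.mul R (R ⧸ I))
    (H i j (i + j + 1)) a.1 b.1, ?_⟩
  exact tensor_homotopy (A := R ⧸ I) (P.complex.d i (i - 1)).hom
    (Q.complex.d j (j - 1)).hom (T'.complex.d (i + j + 1) (i + j)).hom (H i j (i + j + 1))
    (H (i - 1) j (i + j)) (H i (j - 1) (i + j)) ((-1) ^ (s + i)) (φ.map i j (i + j))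
    (h.f (i + j)).hom (f.f i).hom (g.f j).hom (φ'.map i j (i + j)) (hH i j (i + j) rfl) a.1 b.1
    a.2 b.2

theorem torMul_eq (I : Ideal R) (φ : Pairing P Q T β s) (i j : ℕ) :
    torMul I β s i j = φ.torMul I i j :=
  Pairing.torMul_eq I _ φ i j

theorem Pairing.torMul_symm_mk (I : Ideal R) (φ : Pairing P Q T β s) (i j : ℕ)
    (z : LinearMap.ker ((tensorComplex I P).d i (i - 1)).hom)
    (w : LinearMap.ker ((tensorComplex I Q).d j (j - 1)).hom) :
    ∃ h, φ.torMul I i j ((torEquiv I P i).symm (Submodule.Quotient.mk z))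
      ((torEquiv I Q j).symm (Submodule.Quotient.mk w)) =
      (torEquiv I T (i + j)).symm (Submodule.Quotient.mk
        ⟨TensorProduct.map₂ (LinearMap.mul R (R ⧸ I)) (φ.map i j (i + j)) z.1 w.1, h⟩) := by
  refine ⟨?_, ?_⟩
  swap
  · rw [Pairing.torMul, LinearMap.compr₂_apply, LinearMap.compl₁₂_apply, LinearEquiv.coe_coe,
      LinearEquiv.coe_coe, LinearEquiv.coe_coe, LinearEquiv.apply_symm_apply,
      LinearEquiv.apply_symm_apply]
    rfl

end Independence

end

section

variable {R : Type u} [CommRing R]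

/-! ### Projective resolutions from exact sequences -/

section OfExact

/-- A projective resolution from an augmented exact complex of projective modules. -/
noncomputable def resolutionOfAugmented (K : ChainComplex (ModuleCat.{u} R) ℕ)
    {Z : ModuleCat.{u} R} (hK : ∀ k, Projective (K.X k)) (ε : K.X 0 ⟶ Z)
    (hd : ∀ k, LinearMap.range (K.d (k + 2) (k + 1)).hom = LinearMap.ker (K.d (k + 1) k).hom)
    (hε : LinearMap.range (K.d 1 0).hom = LinearMap.ker ε.hom)
    (hs : Function.Surjective ε.hom) : ProjectiveResolution Z where
  complex := K
  projective := hK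
  π := (ChainComplex.toSingle₀Equiv K Z).symm ⟨ε, by
    refine ModuleCat.hom_ext (LinearMap.ext fun x => ?_)
    exact LinearMap.congr_fun (LinearMap.range_le_ker_iff.1 hε.le) x⟩
  quasiIso := ⟨fun k => by
    rcases k with _ | k
    -- In degree zero a quasi-isomorphism to the augmented module means exactness at `K.X 0` and
    -- surjectivity of the augmentation; in positive degrees it means exactness.
    · rw [ChainComplex.quasiIsoAt₀_iff, ShortComplex.quasiIso_iff_of_zeros']
      · constructor
        · rw [ShortComplex.moduleCat_exact_iff_range_eq_ker]
          change LinearMap.range (K.d 1 0).hom = LinearMap.ker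
            (((ChainComplex.toSingle₀Equiv K Z).symm ⟨ε, _⟩).f 0).hom
          rw [ChainComplex.toSingle₀Equiv_symm_apply_f_zero]
          exact hε
        · rw [ModuleCat.epi_iff_surjective]
          change Function.Surjective (((ChainComplex.toSingle₀Equiv K Z).symm ⟨ε, _⟩).f 0).hom
          rw [ChainComplex.toSingle₀Equiv_symm_apply_f_zero]
          exact hs
      · exact K.shape 0 0 (by simp)
      all_goals rfl
    · rw [quasiIsoAt_iff_exactAt']
      · rw [HomologicalComplex.exactAt_iff' _ (k + 2) (k + 1) k (by simp) (by simp),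
          ShortComplex.moduleCat_exact_iff_range_eq_ker]
        exact hd k
      · exact ChainComplex.exactAt_succ_single_obj _ _⟩

variable {X : ℕ → Type u} [∀ k, AddCommGroup (X k)] [∀ k, Module R (X k)]
  {M : Type u} [AddCommGroup M] [Module R M] (d : ∀ k, X (k + 1) →ₗ[R] X k) (ε : X 0 →ₗ[R] M)

/-- The chain complex with given terms and differentials. -/
noncomputable def complexOfExact (hd : ∀ k, Function.Exact (d (k + 1)) (d k)) :
    ChainComplex (ModuleCat.{u} R) ℕ :=
  ChainComplex.of (fun k => ModuleCat.of R (X k)) (fun k => ModuleCat.ofHom (d k)) fun k => by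
    rw [← ModuleCat.ofHom_comp, (hd k).linearMap_comp_eq_zero]; rfl

theorem complexOfExact_d (hd : ∀ k, Function.Exact (d (k + 1)) (d k)) (k : ℕ) :
    (complexOfExact d hd).d (k + 1) k = ModuleCat.ofHom (d k) :=
  ChainComplex.of_d (fun k => ModuleCat.of R (X k)) (fun k => ModuleCat.ofHom (d k)) k

variable [∀ k, Module.Projective R (X k)] (hd : ∀ k, Function.Exact (d (k + 1)) (d k))
    (hε : Function.Exact (d 0) ε) (hs : Function.Surjective ε)

/-- A projective resolution from an exact sequence of projective modules. -/
noncomputable def resolutionOfExact : ProjectiveResolution (ModuleCat.of R M) :=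
  resolutionOfAugmented (complexOfExact d hd)
    (fun k => (IsProjective.iff_projective (R := R) (X k)).1 inferInstance)
    (ModuleCat.ofHom ε)
    (fun k => by
      rw [complexOfExact_d, complexOfExact_d]
      exact (LinearMap.exact_iff.1 (hd k)).symm)
    (by
      rw [complexOfExact_d]
      exact (LinearMap.exact_iff.1 hε).symm)
    hs

theorem resolutionOfExact_d (k : ℕ) :
    (resolutionOfExact d ε hd hε hs).complex.d (k + 1) k = ModuleCat.ofHom (d k) :=
  complexOfExact_d d hd k

theorem resolutionOfExact_π :
    (resolutionOfExact d ε hd hε hs).π.f 0 = ModuleCat.ofHom ε :=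
  ChainComplex.toSingle₀Equiv_symm_apply_f_zero (C := complexOfExact d hd) (ModuleCat.ofHom ε) _

end OfExact

/-! ### Complexes with zero differential -/

section ZeroDifferential

variable {K : ChainComplex (ModuleCat.{u} R) ℕ} (i : ℕ) (h₁ : K.d i (i - 1) = 0)
  (h₂ : K.d (i + 1) i = 0)

/-- The homology of a complex with zero differentials. -/
noncomputable def homologyEquivOfZero : K.X i ≃ₗ[R] Homology K i :=
  LinearEquiv.ofBijective ((Submodule.mkQ _).comp (LinearMap.id.codRestrict
    (LinearMap.ker (K.d i (i - 1)).hom) fun x => by rw [h₁]; rfl))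
    ⟨by
      rw [← LinearMap.ker_eq_bot, LinearMap.ker_eq_bot']
      intro x hx
      obtain ⟨y, hy⟩ := (Submodule.Quotient.mk_eq_zero _).1 hx
      rw [h₂] at hy
      exact hy.symm,
    fun y => by
      induction y using Submodule.Quotient.induction_on with | _ y =>
      exact ⟨y.1, rfl⟩⟩

end ZeroDifferential

/-! ### The Koszul resolution of I^s / I^(s+1) -/

section KoszulResolution

open MvPolynomial

/-- The homogeneous component of degree `s` splits the inclusion into the free module of
polynomials. -/
instance projective_homogeneousSubmodule (n s : ℕ) :
    Module.Projective R (homogeneousSubmodule (Fin n) R s) :=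
  Module.Projective.of_split (homogeneousSubmodule (Fin n) R s).subtype
    ((homogeneousComponent s).codRestrict _ fun F => homogeneousComponent_mem s F)
    (LinearMap.ext fun F => Subtype.ext (by
      simpa using homogeneousComponent_of_mem (m := s) F.2))

variable {n : ℕ} (r : Fin n → R)

/-- The terms of the Koszul resolution of `I^s / I^(s+1)`. -/
abbrev KoszulTerm (R : Type u) [CommRing R] (n s k : ℕ) : Type u :=
  ⋀[R]^k (Fin n → R) ⊗[R] homogeneousSubmodule (Fin n) R s

/-- The Koszul differential on the exterior powers. -/
noncomputable def koszulPow (i : ℕ) : ⋀[R]^i (Fin n → R) →ₗ[R] ⋀[R]^(i - 1) (Fin n → R) :=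
  (koszulD (seqForm r)).restrict fun _ hx => koszulD_mem _ hx

theorem coe_koszulPow (i : ℕ) (x : ⋀[R]^i (Fin n → R)) :
    (koszulPow r i x : ExteriorAlgebra R (Fin n → R)) = koszulD (seqForm r) x := rfl

theorem koszulPow_zero : koszulPow r 0 = 0 := by
  refine LinearMap.ext fun x => Subtype.ext ?_
  obtain ⟨c, hc⟩ := Submodule.mem_one.1 x.2
  rw [coe_koszulPow, ← hc]
  exact koszulD_algebraMap _ _

/-- The identification of `⋀^0` with the base ring. -/
noncomputable def augPow (R : Type u) [CommRing R] (n : ℕ) : ⋀[R]^0 (Fin n → R) →ₗ[R] R :=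
  ExteriorAlgebra.algebraMapInv.toLinearMap ∘ₗ (⋀[R]^0 (Fin n → R)).subtype

/-- The unit of the exterior algebra, in degree zero. -/
noncomputable def onePow (R : Type u) [CommRing R] (n : ℕ) : ⋀[R]^0 (Fin n → R) :=
  ⟨1, Submodule.mem_one.2 ⟨1, map_one _⟩⟩

theorem augPow_onePow : augPow R n (onePow R n) = 1 :=
  map_one (ExteriorAlgebra.algebraMapInv (R := R) (M := Fin n → R))

theorem augPow_smul_onePow (w : ⋀[R]^0 (Fin n → R)) : augPow R n w • onePow R n = w := by
  obtain ⟨c, hc⟩ := Submodule.mem_one.1 w.2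
  have hw : augPow R n w = c := by
    change ExteriorAlgebra.algebraMapInv (w : ExteriorAlgebra R (Fin n → R)) = c
    rw [← hc, ExteriorAlgebra.algebraMap_leftInverse]
  rw [hw]
  exact Subtype.ext ((Algebra.algebraMap_eq_smul_one c).symm.trans hc)

variable {I : Ideal R} (hI : I = Ideal.span (Set.range r))

/-- The augmentation of the Koszul resolution of `I^s / I^(s+1)`. -/
noncomputable def koszulAug (s : ℕ) : KoszulTerm R n s 0 →ₗ[R] Gr I s :=
  TensorProduct.lift ((LinearMap.lsmul R (Gr I s)).compl₁₂ (augPow R n) (symToGr r hI s))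

theorem koszulAug_tmul (s : ℕ) (w : ⋀[R]^0 (Fin n → R))
    (F : homogeneousSubmodule (Fin n) R s) :
    koszulAug r hI s (w ⊗ₜ F) = augPow R n w • symToGr r hI s F := rfl

theorem koszulAug_surjective (s : ℕ) : Function.Surjective (koszulAug r hI s) := by
  intro y
  obtain ⟨F, rfl⟩ := symToGr_surjective r hI s y
  exact ⟨onePow R n ⊗ₜ F, by rw [koszulAug_tmul, augPow_onePow, one_smul]⟩

/-- The forms of degree `s` are projective, hence flat, so exactness of the Koszul complex is
preserved. -/
theorem koszulTerm_exact (hr : ∀ (i : Fin n) (b : R), r i * b ∈ Ideal.span (r '' {j | j < i}) →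
      b ∈ Ideal.span (r '' {j | j < i}))
    (s k : ℕ) :
    Function.Exact ((koszulPow r (k + 2)).rTensor (homogeneousSubmodule (Fin n) R s))
      ((koszulPow r (k + 1)).rTensor (homogeneousSubmodule (Fin n) R s)) := by
  refine Module.Flat.rTensor_exact _ fun x => ⟨fun hx => ?_, ?_⟩
  · obtain ⟨y, hy, hyx⟩ := koszulExact_seqForm r hr k x x.2 (congrArg Subtype.val hx)
    exact ⟨⟨y, hy⟩, Subtype.ext hyx⟩
  · rintro ⟨y, rfl⟩
    exact Subtype.ext (koszulD_koszulD _ _)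

theorem exists_eq_onePow_tmul {s : ℕ} (z : KoszulTerm R n s 0) :
    ∃ F, z = onePow R n ⊗ₜ F := by
  induction z using TensorProduct.induction_on with
  | zero => exact ⟨0, (TensorProduct.tmul_zero _ _).symm⟩
  | tmul w F =>
    exact ⟨augPow R n w • F, by rw [← TensorProduct.smul_tmul, augPow_smul_onePow]⟩
  | add a b ha hb =>
    obtain ⟨F, rfl⟩ := ha
    obtain ⟨G, rfl⟩ := hb
    exact ⟨F + G, (TensorProduct.tmul_add _ _ _).symm⟩

/-- The image of Λ^1 in Λ^0 = R is I, so the image of the differential is I · S^s, which is the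
kernel of the augmentation by quasi-regularity. -/
theorem koszulAug_exact (hr : ∀ (i : Fin n) (b : R), r i * b ∈ Ideal.span (r '' {j | j < i}) →
      b ∈ Ideal.span (r '' {j | j < i}))
    (s : ℕ) :
    Function.Exact ((koszulPow r 1).rTensor (homogeneousSubmodule (Fin n) R s))
      (koszulAug r hI s) := by
  have hsm : ∀ c ∈ I, ∃ u : ⋀[R]^1 (Fin n → R), koszulPow r 1 u = c • onePow R n := by
    intro c hc
    rw [hI, ← range_seqForm] at hc
    obtain ⟨y, hy, hyc⟩ := exists_koszulD_eq_of_algebraMap (seqForm r) hc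
    refine ⟨⟨y, hy⟩, Subtype.ext ?_⟩
    rw [coe_koszulPow]
    exact hyc.trans (Algebra.algebraMap_eq_smul_one c)
  intro z
  constructor
  · intro hz
    obtain ⟨F, rfl⟩ := exists_eq_onePow_tmul z
    rw [koszulAug_tmul, augPow_onePow, one_smul] at hz
    have hF := mem_smul_top_of_symToGr_eq_zero r hI s hr F hz
    rw [← LinearMap.coe_range, SetLike.mem_coe]
    clear hz
    induction hF using Submodule.smul_induction_on' with
    | smul c hc G _ =>
      obtain ⟨u, hu⟩ := hsm c hc
      exact ⟨u ⊗ₜ G, by rw [LinearMap.rTensor_tmul, hu, TensorProduct.smul_tmul]⟩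
    | add F _ G _ hF hG =>
      rw [TensorProduct.tmul_add]; exact add_mem hF hG
  · rintro ⟨w, rfl⟩
    induction w using TensorProduct.induction_on with
    | zero => simp
    | add a b ha hb => rw [map_add, map_add, ha, hb, add_zero]
    | tmul u F =>
      rw [LinearMap.rTensor_tmul, koszulAug_tmul]
      have hu : augPow R n (koszulPow r 1 u) ∈ I := by
        rw [hI, ← range_seqForm]
        refine algebraMap_mem_of_koszulD (seqForm r) u.2 ?_
        rw [← coe_koszulPow]
        conv_lhs => rw [← augPow_smul_onePow (koszulPow r 1 u)]
        exact (Algebra.algebraMap_eq_smul_one _).symm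
      rw [symToGr_apply, ← Submodule.Quotient.mk_smul, Submodule.Quotient.mk_eq_zero]
      change augPow R n (koszulPow r 1 u) * eval r (F : MvPolynomial (Fin n) R) ∈ I ^ (s + 1)
      rw [pow_succ']
      refine Ideal.mul_mem_mul hu ?_
      rw [hI]
      exact (Ideal.mem_span_pow_iff_exists_isHomogeneous r _).2 ⟨F, F.2, rfl⟩

variable (hr : ∀ (i : Fin n) (b : R), r i * b ∈ Ideal.span (r '' {j | j < i}) →
      b ∈ Ideal.span (r '' {j | j < i}))

/-- The Koszul resolution of `I^s / I^(s+1)`. -/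
noncomputable def koszulResolution (s : ℕ) : ProjectiveResolution (ModuleCat.of R (Gr I s)) :=
  resolutionOfExact (X := KoszulTerm R n s)
    (fun k => (koszulPow r (k + 1)).rTensor (homogeneousSubmodule (Fin n) R s))
    (koszulAug r hI s) (koszulTerm_exact r hr s) (koszulAug_exact r hI hr s)
    (koszulAug_surjective r hI s)

theorem koszulResolution_d (s i : ℕ) :
    ((koszulResolution r hI hr s).complex.d i (i - 1)).hom =
      (koszulPow r i).rTensor (homogeneousSubmodule (Fin n) R s) := by
  rcases i with _ | i
  · rw [koszulPow_zero, (koszulResolution r hI hr s).complex.shape _ _ (by simp),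
      LinearMap.rTensor_zero]
    rfl
  · exact congrArg ModuleCat.Hom.hom (resolutionOfExact_d (X := KoszulTerm R n s) _ _ _ _ _ i)

theorem koszulResolution_π (s : ℕ) :
    ((koszulResolution r hI hr s).π.f 0).hom = koszulAug r hI s :=
  congrArg ModuleCat.Hom.hom (resolutionOfExact_π (X := KoszulTerm R n s) _ _ _ _ _)

end KoszulResolution

/-! ### The product on Koszul resolutions -/

section KoszulPairing

open MvPolynomial

variable {n : ℕ} (r : Fin n → R)

/-- The degree `k` part of the product of elements of degrees `i` and `j` of the exterior
algebra. -/
noncomputable def extMul (R : Type u) [CommRing R] (n i j k : ℕ) :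
    ⋀[R]^i (Fin n → R) →ₗ[R] ⋀[R]^j (Fin n → R) →ₗ[R] ⋀[R]^k (Fin n → R) :=
  (((LinearMap.mul R (ExteriorAlgebra R (Fin n → R))).compl₁₂ (⋀[R]^i (Fin n → R)).subtype
    (⋀[R]^j (Fin n → R)).subtype)).compr₂
    (DirectSum.component R ℕ (fun k => ⋀[R]^k (Fin n → R)) k ∘ₗ
      (decomposeLinearEquiv (fun k : ℕ => ⋀[R]^k (Fin n → R))).toLinearMap)

/-- Taking the degree `k` part changes nothing when `k = i + j`. A free index `k`, as in `Pairing`,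
avoids transport along equalities of degrees. -/
theorem coe_extMul {i j k : ℕ} (h : i + j = k) (u : ⋀[R]^i (Fin n → R))
    (v : ⋀[R]^j (Fin n → R)) :
    (extMul R n i j k u v : ExteriorAlgebra R (Fin n → R)) = u * v :=
  decompose_of_mem_same (fun k : ℕ => ⋀[R]^k (Fin n → R))
    (h ▸ SetLike.mul_mem_graded u.2 v.2)

theorem koszulPow_extMul {i j k : ℕ} (h : i + j = k + 1) (u : ⋀[R]^i (Fin n → R))
    (v : ⋀[R]^j (Fin n → R)) :
    koszulPow r (k + 1) (extMul R n i j (k + 1) u v) =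
      extMul R n (i - 1) j k (koszulPow r i u) v +
        (-1 : ℤ) ^ i • extMul R n i (j - 1) k u (koszulPow r j v) := by
  apply Subtype.ext
  rw [coe_koszulPow, coe_extMul h, koszulD_mul _ u.2]
  push_cast
  congr 1
  -- For `i = 0` the product with index `i - 1` has the wrong degree, but its argument is zero;
  -- likewise for `j = 0`.
  · rcases i with _ | i
    · rw [koszulPow_zero, ← coe_koszulPow, koszulPow_zero]; simp
    · rw [coe_extMul (by omega), coe_koszulPow]
  · congr 1
    rcases j with _ | j
    · rw [koszulPow_zero, ← coe_koszulPow, koszulPow_zero]; simp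
    · rw [coe_extMul (by omega), coe_koszulPow]

/-- The product of homogeneous polynomials. -/
noncomputable def symMul (R : Type u) [CommRing R] (n s t : ℕ) :
    homogeneousSubmodule (Fin n) R s →ₗ[R] homogeneousSubmodule (Fin n) R t →ₗ[R]
      homogeneousSubmodule (Fin n) R (s + t) :=
  LinearMap.mk₂ R (fun F G => ⟨F * G, IsHomogeneous.mul F.2 G.2⟩)
    (fun _ _ _ => Subtype.ext (add_mul _ _ _)) (fun _ _ _ => Subtype.ext (smul_mul_assoc _ _ _))
    (fun _ _ _ => Subtype.ext (mul_add _ _ _)) (fun _ _ _ => Subtype.ext (mul_smul_comm _ _ _))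

theorem coe_symMul {s t : ℕ} (F : homogeneousSubmodule (Fin n) R s)
    (G : homogeneousSubmodule (Fin n) R t) :
    (symMul R n s t F G : MvPolynomial (Fin n) R) = F * G := rfl

/-- The signed product on the terms of the Koszul resolutions. -/
noncomputable def koszulMul (R : Type u) [CommRing R] (n s t i j k : ℕ) :
    KoszulTerm R n s i →ₗ[R] KoszulTerm R n t j →ₗ[R] KoszulTerm R n (s + t) k :=
  (TensorProduct.map₂ (extMul R n i j k) (symMul R n s t)).compr₂
    ((-1 : ℤ) ^ (s * j) • LinearMap.id)

theorem koszulMul_tmul (s t i j k : ℕ) (u : ⋀[R]^i (Fin n → R))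
    (F : homogeneousSubmodule (Fin n) R s) (v : ⋀[R]^j (Fin n → R))
    (G : homogeneousSubmodule (Fin n) R t) :
    koszulMul R n s t i j k (u ⊗ₜ F) (v ⊗ₜ G) =
      (-1 : ℤ) ^ (s * j) • (extMul R n i j k u v ⊗ₜ symMul R n s t F G) := rfl

theorem zsmul_zsmul_tmul {M N : Type*} [AddCommGroup M] [Module R M] [AddCommGroup N] [Module R N]
    (c d e : ℤ) (x : M) (y : N) (h : c * d = e) :
    c • ((d • x) ⊗ₜ[R] y) = e • (x ⊗ₜ[R] y) := by
  rw [← h, mul_smul]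
  exact congrArg (c • ·) (map_zsmul ((TensorProduct.mk R M N).flip y) d x)

/-- The first terms carry the same sign as `j` is unchanged. In the second ones the exponents `s j +
i` and `(s + i) + s (j - 1)` agree for `j > 0`: this is the reason for the sign in `koszulMul`. For
`j = 0` those terms vanish. -/
theorem koszulMul_leibniz (s t : ℕ) {i j k : ℕ} (h : i + j = k + 1) (x : KoszulTerm R n s i)
    (y : KoszulTerm R n t j) :
    (koszulPow r (k + 1)).rTensor (homogeneousSubmodule (Fin n) R (s + t))
      (koszulMul R n s t i j (k + 1) x y) =
      koszulMul R n s t (i - 1) j k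
        ((koszulPow r i).rTensor (homogeneousSubmodule (Fin n) R s) x) y +
      (-1 : ℤ) ^ (s + i) • koszulMul R n s t i (j - 1) k x
        ((koszulPow r j).rTensor (homogeneousSubmodule (Fin n) R t) y) := by
  induction x using TensorProduct.induction_on with
  | zero => simp
  | add x x' hx hx' =>
    simp only [map_add, LinearMap.add_apply, hx, hx', smul_add]
    abel
  | tmul u F =>
    induction y using TensorProduct.induction_on with
    | zero => simp
    | add y y' hy hy' =>
      simp only [map_add, hy, hy', smul_add]
      abel
    | tmul v G =>
      rw [koszulMul_tmul, map_zsmul, LinearMap.rTensor_tmul, koszulPow_extMul r h,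
        LinearMap.rTensor_tmul, LinearMap.rTensor_tmul, koszulMul_tmul, koszulMul_tmul,
        TensorProduct.add_tmul, smul_add, smul_smul]
      congr 1
      rcases j with _ | j
      · simp [koszulPow_zero]
      · exact zsmul_zsmul_tmul _ _ _ _ _ (by
          rw [← pow_add, ← pow_add, Nat.add_sub_cancel]
          congr 1
          ring)

variable {I : Ideal R} (hI : I = Ideal.span (Set.range r))
  (hr : ∀ (i : Fin n) (b : R), r i * b ∈ Ideal.span (r '' {j | j < i}) →
      b ∈ Ideal.span (r '' {j | j < i}))

theorem symToGr_symMul (s t : ℕ) (F : homogeneousSubmodule (Fin n) R s)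
    (G : homogeneousSubmodule (Fin n) R t) :
    symToGr r hI (s + t) (symMul R n s t F G) =
      grMul I s t (symToGr r hI s F) (symToGr r hI t G) := by
  rw [symToGr_apply, symToGr_apply, symToGr_apply, grMul_mk]
  exact congrArg Submodule.Quotient.mk (Subtype.ext (map_mul (eval r) _ _))

theorem koszulAug_koszulMul (s t : ℕ) (x : KoszulTerm R n s 0) (y : KoszulTerm R n t 0) :
    koszulAug r hI (s + t) (koszulMul R n s t 0 0 0 x y) =
      grMul I s t (koszulAug r hI s x) (koszulAug r hI t y) := by
  obtain ⟨F, rfl⟩ := exists_eq_onePow_tmul x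
  obtain ⟨G, rfl⟩ := exists_eq_onePow_tmul y
  have h1 : extMul R n 0 0 0 (onePow R n) (onePow R n) = onePow R n :=
    Subtype.ext ((coe_extMul rfl _ _).trans (mul_one _))
  rw [koszulMul_tmul, h1, mul_zero, pow_zero, one_smul, koszulAug_tmul, koszulAug_tmul,
    koszulAug_tmul, augPow_onePow, one_smul, one_smul, one_smul, symToGr_symMul]

/-- The pairing of Koszul resolutions over the multiplication of the associated graded ring. -/
noncomputable def koszulPairing (s t : ℕ) :
    Pairing (koszulResolution r hI hr s) (koszulResolution r hI hr t)
      (koszulResolution r hI hr (s + t)) (grMul I s t) s where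
  map i j k := koszulMul R n s t i j k
  leibniz i j k h x y := by
    rw [koszulResolution_d, koszulResolution_d]
    have e := koszulResolution_d r hI hr (s + t) (k + 1)
    exact (LinearMap.congr_fun e _).trans (koszulMul_leibniz r s t h x y)
  augmentation x y := by
    rw [koszulResolution_π, koszulResolution_π, koszulResolution_π]
    exact koszulAug_koszulMul r hI s t x y

end KoszulPairing

end

/-! ### Base change of exterior powers and forms -/

section BaseChange

open MvPolynomial

variable (R A : Type*) [CommRing R] [CommRing A] [Algebra R A] (n : ℕ)

/-- The base change map between the exterior algebras of `R^n` and `A^n`. -/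
noncomputable def extBase :
    ExteriorAlgebra R (Fin n → R) →ₐ[R] ExteriorAlgebra A (Fin n → A) :=
  ExteriorAlgebra.lift R ⟨((ExteriorAlgebra.ι A).restrictScalars R).comp
    ((Algebra.linearMap R A).compLeft (Fin n)), fun _ => ExteriorAlgebra.ι_sq_zero _⟩

theorem extBase_ι (v : Fin n → R) :
    extBase R A n (ExteriorAlgebra.ι R v) = ExteriorAlgebra.ι A fun i => algebraMap R A (v i) :=
  ExteriorAlgebra.lift_ι_apply ..

/-- The base change map between polynomial rings. -/
noncomputable def polyBase : MvPolynomial (Fin n) R →ₐ[R] MvPolynomial (Fin n) A :=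
  mapAlgHom (Algebra.ofId R A)

variable {n}

theorem extBase_mem {k : ℕ} {x : ExteriorAlgebra R (Fin n → R)} (hx : x ∈ ⋀[R]^k (Fin n → R)) :
    extBase R A n x ∈ ⋀[A]^k (Fin n → A) := by
  induction hx using exteriorPower_induction with
  | algebraMap c =>
    rw [AlgHom.commutes, IsScalarTower.algebraMap_apply R A]
    exact Submodule.mem_one.2 ⟨_, rfl⟩
  | add k x y _ _ hx hy => rw [map_add]; exact add_mem hx hy
  | ι_mul k m x _ ih => rw [map_mul, extBase_ι]; exact ι_mul_mem _ ih

theorem polyBase_mem {s : ℕ} {F : MvPolynomial (Fin n) R}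
    (hF : F ∈ homogeneousSubmodule (Fin n) R s) :
    polyBase R A n F ∈ homogeneousSubmodule (Fin n) A s :=
  IsHomogeneous.map hF _

/-- The base change map between exterior powers. -/
noncomputable def extPowBase (k : ℕ) :
    ⋀[R]^k (Fin n → R) →ₗ[R] ⋀[A]^k (Fin n → A) :=
  (extBase R A n).toLinearMap.restrict (p := ⋀[R]^k (Fin n → R))
    (q := (⋀[A]^k (Fin n → A)).restrictScalars R) fun _ hx => extBase_mem R A hx

/-- The base change map between homogeneous polynomials. -/
noncomputable def homBase (s : ℕ) :
    homogeneousSubmodule (Fin n) R s →ₗ[R] homogeneousSubmodule (Fin n) A s :=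
  (polyBase R A n).toLinearMap.restrict (p := homogeneousSubmodule (Fin n) R s)
    (q := (homogeneousSubmodule (Fin n) A s).restrictScalars R) fun _ hx => polyBase_mem R A hx

theorem coe_extPowBase (k : ℕ) (u : ⋀[R]^k (Fin n → R)) :
    (extPowBase R A k u : ExteriorAlgebra A (Fin n → A)) = extBase R A n u := rfl

theorem coe_homBase (s : ℕ) (F : homogeneousSubmodule (Fin n) R s) :
    (homBase R A s F : MvPolynomial (Fin n) A) = polyBase R A n F := rfl

/-- The monomials of degree `s`. -/
noncomputable def homMonomial (n s : ℕ) (d : {d : Fin n →₀ ℕ // d.degree = s}) :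
    homogeneousSubmodule (Fin n) R s :=
  ⟨monomial d 1, isHomogeneous_monomial _ d.2⟩

/-- The basis of the module of homogeneous polynomials given by the monomials. -/
noncomputable def homBasis (n s : ℕ) :
    Module.Basis {d : Fin n →₀ ℕ // d.degree = s} R (homogeneousSubmodule (Fin n) R s) :=
  Module.Basis.mk (v := homMonomial R n s)
    (LinearIndependent.of_comp (homogeneousSubmodule (Fin n) R s).subtype (by
      have h := (basisMonomials (Fin n) R).linearIndependent.comp
        (Subtype.val : {d : Fin n →₀ ℕ // d.degree = s} → _) Subtype.val_injective
      convert h using 1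
      ext d : 1
      simp [homMonomial]))
    (by
      classical
      rintro F -
      have hd : ∀ d ∈ (F : MvPolynomial (Fin n) R).support, d.degree = s := by
        intro d hd
        have := F.2 (mem_support_iff.1 hd)
        rwa [Finsupp.degree_eq_weight_one]
      have hF : F = ∑ d ∈ (F : MvPolynomial (Fin n) R).support.attach,
          coeff d (F : MvPolynomial (Fin n) R) • homMonomial R n s ⟨d.1, hd _ d.2⟩ := by
        apply Subtype.ext
        rw [AddSubmonoidClass.coe_finsetSum]
        conv_lhs => rw [(F : MvPolynomial (Fin n) R).as_sum, ← Finset.sum_attach]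
        refine Finset.sum_congr rfl fun d _ => ?_
        simp [homMonomial, smul_monomial]
      rw [hF]
      exact sum_mem fun d _ => Submodule.smul_mem _ _ (Submodule.subset_span ⟨_, rfl⟩))

theorem homBase_homBasis (s : ℕ) (d : {d : Fin n →₀ ℕ // d.degree = s}) :
    homBase R A s (homBasis R n s d) = homBasis A n s d := by
  rw [homBasis, homBasis, Module.Basis.mk_apply, Module.Basis.mk_apply]
  apply Subtype.ext
  simp [coe_homBase, homMonomial, polyBase]

/-- The standard basis of the exterior powers of `R^n`. -/
noncomputable def extBasis (n k : ℕ) :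
    Module.Basis (Set.powersetCard (Fin n) k) R (⋀[R]^k (Fin n → R)) :=
  (Pi.basisFun R (Fin n)).exteriorPower k

theorem extPowBase_extBasis (k : ℕ) (d : Set.powersetCard (Fin n) k) :
    extPowBase R A k (extBasis R n k d) = extBasis A n k d := by
  apply Subtype.ext
  rw [coe_extPowBase, extBasis, extBasis, exteriorPower.basis_apply, exteriorPower.basis_apply,
    exteriorPower.ιMulti_family_apply_coe, exteriorPower.ιMulti_family_apply_coe,
    ExteriorAlgebra.ιMulti_family, ExteriorAlgebra.ιMulti_family, ExteriorAlgebra.ιMulti_apply,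
    ExteriorAlgebra.ιMulti_apply, map_list_prod, List.map_ofFn]
  congr 2
  ext i
  simp only [Function.comp_apply, extBase_ι, Pi.basisFun_apply]
  congr 1
  ext j
  simp [Pi.single_apply, apply_ite (algebraMap R A)]

/-- Base change for the tensor product of exterior powers and forms. -/
noncomputable def baseChangeEquiv (n s k : ℕ) :
    A ⊗[R] (⋀[R]^k (Fin n → R) ⊗[R] homogeneousSubmodule (Fin n) R s) ≃ₗ[A]
      homogeneousSubmodule (Fin n) A s ⊗[A] ⋀[A]^k (Fin n → A) :=
  ((((extBasis R n k).tensorProduct (homBasis R n s)).baseChange A).equiv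
    ((extBasis A n k).tensorProduct (homBasis A n s)) (Equiv.refl _)).trans
    -- The forms come first so that the order of the factors matches the index `(s, k)` of
    -- `TorPiece`.
    (TensorProduct.comm A _ _)

/-- The equivalence is defined through bases; it is the natural map because base change carries
monomials to monomials and standard exterior basis elements to the same. Linearity over `A` reduces
to `a = 1`. -/
theorem baseChangeEquiv_tmul (s k : ℕ) (a : A) (u : ⋀[R]^k (Fin n → R))
    (F : homogeneousSubmodule (Fin n) R s) :
    baseChangeEquiv R A n s k (a ⊗ₜ (u ⊗ₜ F)) =
      a • (homBase R A s F ⊗ₜ extPowBase R A k u) := by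
  suffices h : ((baseChangeEquiv R A n s k).toLinearMap.restrictScalars R ∘ₗ
      TensorProduct.mk R A _ 1) = TensorProduct.lift (((TensorProduct.mk A
        (homogeneousSubmodule (Fin n) A s) (⋀[A]^k (Fin n → A))).restrictScalars₁₂ R R).flip.compl₁₂
          (extPowBase R A k) (homBase R A s)) by
    have e := LinearMap.congr_fun h (u ⊗ₜ F)
    rw [← mul_one a, ← smul_eq_mul, ← TensorProduct.smul_tmul', map_smul]
    simpa using congrArg (a • ·) e
  refine ((extBasis R n k).tensorProduct (homBasis R n s)).ext fun d => ?_
  have e : baseChangeEquiv R A n s k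
      (((((extBasis R n k).tensorProduct (homBasis R n s)).baseChange A) d)) =
      homBasis A n s d.2 ⊗ₜ extBasis A n k d.1 := by
    rw [baseChangeEquiv, LinearEquiv.trans_apply, Module.Basis.equiv_apply, Equiv.refl_apply,
      Module.Basis.tensorProduct_apply', TensorProduct.comm_tmul]
  rw [Module.Basis.baseChange_apply] at e
  refine e.trans ?_
  rw [Module.Basis.tensorProduct_apply']
  change _ = homBase R A s (homBasis R n s d.2) ⊗ₜ[A] extPowBase R A k (extBasis R n k d.1)
  rw [homBase_homBasis, extPowBase_extBasis]

end BaseChange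

section

variable {R : Type u} [CommRing R]

/-! ### Tor and its product from the Koszul resolution -/

section KoszulTor

open MvPolynomial

variable {n : ℕ} (r : Fin n → R) {I : Ideal R} (hI : I = Ideal.span (Set.range r))
  (hr : ∀ (i : Fin n) (b : R), r i * b ∈ Ideal.span (r '' {j | j < i}) →
      b ∈ Ideal.span (r '' {j | j < i}))

/-- The Koszul complex is minimal: the coefficients produced by contraction are values of `f`. This
makes the differential vanish modulo I. -/
theorem koszulD_mem_smul {M : Type*} [AddCommGroup M] [Module R M] (f : Module.Dual R M)
    (J : Ideal R) (hf : LinearMap.range f ≤ J) {k : ℕ} {x : ExteriorAlgebra R M}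
    (hx : x ∈ ⋀[R]^k M) : koszulD f x ∈ J • ⋀[R]^(k - 1) M := by
  induction hx using exteriorPower_induction with
  | algebraMap c => rw [koszulD_algebraMap]; exact zero_mem _
  | add k x y _ _ hx hy => rw [map_add]; exact add_mem hx hy
  | ι_mul k m x hx ih =>
    rw [koszulD_ι_mul]
    refine sub_mem (Submodule.smul_mem_smul (hf ⟨m, rfl⟩) hx) ?_
    rcases k with _ | k
    · obtain ⟨c, rfl⟩ := Submodule.mem_one.1 hx
      rw [koszulD_algebraMap, mul_zero]
      exact zero_mem _
    · have h := Submodule.mem_map_of_mem (f := LinearMap.mulLeft R (ExteriorAlgebra.ι R m)) ih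
      rw [Submodule.map_smul''] at h
      refine Submodule.smul_mono le_rfl ?_ h
      rintro _ ⟨y, hy, rfl⟩
      exact ι_mul_mem m hy

theorem tmul_eq_zero_of_mem_smul_top {M : Type*} [AddCommGroup M] [Module R M] (J : Ideal R)
    (a : R ⧸ J) {x : M} (hx : x ∈ J • (⊤ : Submodule R M)) : a ⊗ₜ[R] x = 0 := by
  induction hx using Submodule.smul_induction_on' with
  | smul c hc y _ =>
    rw [← TensorProduct.smul_tmul, Algebra.smul_def, Ideal.Quotient.algebraMap_eq,
      Ideal.Quotient.eq_zero_iff_mem.2 hc, zero_mul, TensorProduct.zero_tmul]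
  | add x _ y _ hx hy => rw [TensorProduct.tmul_add, hx, hy, add_zero]

theorem tmul_mem_smul_top {M N : Type*} [AddCommGroup M] [Module R M] [AddCommGroup N] [Module R N]
    (J : Ideal R) {x : M} (hx : x ∈ J • (⊤ : Submodule R M)) (y : N) :
    x ⊗ₜ[R] y ∈ J • (⊤ : Submodule R (M ⊗[R] N)) := by
  induction hx using Submodule.smul_induction_on' with
  | smul c hc z _ =>
    rw [← TensorProduct.smul_tmul']
    exact Submodule.smul_mem_smul hc trivial
  | add x _ z _ hx hz => rw [TensorProduct.add_tmul]; exact add_mem hx hz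

theorem lTensor_rTensor_eq_zero {M M' N : Type*} [AddCommGroup M] [Module R M] [AddCommGroup M']
    [Module R M'] [AddCommGroup N] [Module R N] (J : Ideal R) (f : M →ₗ[R] M')
    (hf : ∀ u, f u ∈ J • (⊤ : Submodule R M')) : (f.rTensor N).lTensor (R ⧸ J) = 0 :=
  TensorProduct.ext (LinearMap.ext fun a => TensorProduct.ext (LinearMap.ext fun u =>
    LinearMap.ext fun y => tmul_eq_zero_of_mem_smul_top J a (tmul_mem_smul_top J (hf u) y)))

theorem lTensor_koszulPow_eq_zero (hI : I = Ideal.span (Set.range r)) (s k : ℕ) :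
    ((koszulPow r k).rTensor (homogeneousSubmodule (Fin n) R s)).lTensor (R ⧸ I) = 0 := by
  refine lTensor_rTensor_eq_zero I _ fun u => ?_
  rw [Submodule.mem_smul_top_iff, coe_koszulPow]
  exact koszulD_mem_smul _ I (by rw [range_seqForm, hI]) u.2

theorem tensorComplex_koszul_d (s k : ℕ) :
    (tensorComplex I (koszulResolution r hI hr s)).d k (k - 1) = 0 := by
  refine ModuleCat.hom_ext ?_
  have h : ((tensorComplex I (koszulResolution r hI hr s)).d k (k - 1)).hom =
    ((koszulResolution r hI hr s).complex.d k (k - 1)).hom.lTensor (R ⧸ I) := rfl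
  rw [h, koszulResolution_d]
  exact lTensor_koszulPow_eq_zero r hI s k

/-- The computation of Tor by means of the Koszul resolution. -/
noncomputable def koszulTor (p : ℕ × ℕ) :
    ((R ⧸ I) ⊗[R] KoszulTerm R n p.1 p.2) ≃ₗ[R] TorPiece I p :=
  (homologyEquivOfZero (K := tensorComplex I (koszulResolution r hI hr p.1)) p.2
    (tensorComplex_koszul_d r hI hr p.1 p.2) (tensorComplex_koszul_d r hI hr p.1 (p.2 + 1))).trans
    (torEquiv I (koszulResolution r hI hr p.1) p.2).symm

/-- By independence the exterior product may be computed with the Koszul pairing. All elements of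
the reduced complex are cycles, so the formula holds on every pair of elements. -/
theorem pieceMul_koszulTor (p q : ℕ × ℕ) (z : (R ⧸ I) ⊗[R] KoszulTerm R n p.1 p.2)
    (w : (R ⧸ I) ⊗[R] KoszulTerm R n q.1 q.2) :
    pieceMul I p q (koszulTor r hI hr p z) (koszulTor r hI hr q w) =
      koszulTor r hI hr (p + q) (TensorProduct.map₂ (LinearMap.mul R (R ⧸ I))
        (koszulMul R n p.1 q.1 p.2 q.2 (p.2 + q.2)) z w) := by
  have h := torMul_eq I (koszulPairing r hI hr p.1 q.1) p.2 q.2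
  obtain ⟨_, e⟩ := (koszulPairing r hI hr p.1 q.1).torMul_symm_mk I p.2 q.2
    ⟨z, by rw [tensorComplex_koszul_d]; rfl⟩ ⟨w, by rw [tensorComplex_koszul_d]; rfl⟩
  exact (LinearMap.congr_fun (LinearMap.congr_fun h _) _).trans e

/-- The element `1 ⊗ 1` of Λ^0 ⊗ S^0 is a lift of the class of 1 through the augmentation. -/
theorem gOne_eq_koszulTor :
    (GradedMonoid.GOne.one : TorPiece I 0) = koszulTor r hI hr 0
      (1 ⊗ₜ (onePow R n ⊗ₜ ⟨1, isHomogeneous_one _ _⟩)) := by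
  refine (LinearEquiv.eq_symm_apply _).2 ?_
  have h := torEquiv_torZero I (koszulResolution r hI hr 0)
    (onePow R n ⊗ₜ (⟨1, isHomogeneous_one _ _⟩ : homogeneousSubmodule (Fin n) R 0))
  refine Eq.trans ?_ h
  refine congrArg (fun m => torEquiv I (koszulResolution r hI hr 0) 0 (torZero I m)) ?_
  refine Eq.symm ?_
  refine (LinearMap.congr_fun (koszulResolution_π r hI hr 0) _).trans ?_
  refine (koszulAug_tmul r hI 0 _ _).trans ?_
  rw [augPow_onePow, one_smul, symToGr_apply]
  exact congrArg Submodule.Quotient.mk (Subtype.ext (map_one _))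

instance isScalarTower_torPiece (p : ℕ × ℕ) : IsScalarTower R (R ⧸ I) (TorPiece I p) := by
  refine ⟨fun c a x => ?_⟩
  obtain ⟨b, rfl⟩ := Ideal.Quotient.mk_surjective a
  exact mul_smul c b x

end KoszulTor

/-! ### The isomorphism of bigraded algebras -/

section TorGrEquiv

open MvPolynomial

attribute [local instance] MvPolynomial.gradedAlgebra

variable {n : ℕ} (r : Fin n → R) {I : Ideal R} (hI : I = Ideal.span (Set.range r))
  (hr : ∀ (i : Fin n) (b : R), r i * b ∈ Ideal.span (r '' {j | j < i}) →
      b ∈ Ideal.span (r '' {j | j < i}))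

/-- `Tor_k(R/I, I^s / I^(s+1))` is the tensor product of forms and exterior powers. -/
noncomputable def torPieceEquiv (p : ℕ × ℕ) :
    TorPiece I p ≃ₗ[R ⧸ I] homogeneousSubmodule (Fin n) (R ⧸ I) p.1 ⊗[R ⧸ I]
      ⋀[R ⧸ I]^p.2 (Fin n → R ⧸ I) :=
  -- An R-linear map between R/I-modules is R/I-linear because R → R/I is surjective.
  ((koszulTor r hI hr p).extendScalarsOfSurjective Ideal.Quotient.mk_surjective).symm.trans
    (baseChangeEquiv R (R ⧸ I) n p.1 p.2)

theorem torPieceEquiv_koszulTor (p : ℕ × ℕ) (a : R ⧸ I) (u : ⋀[R]^p.2 (Fin n → R))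
    (F : homogeneousSubmodule (Fin n) R p.1) :
    torPieceEquiv r hI hr p (koszulTor r hI hr p (a ⊗ₜ (u ⊗ₜ F))) =
      a • (homBase R (R ⧸ I) p.1 F ⊗ₜ extPowBase R (R ⧸ I) p.2 u) := by
  rw [← baseChangeEquiv_tmul]
  exact congrArg (baseChangeEquiv R (R ⧸ I) n p.1 p.2)
    ((koszulTor r hI hr p).symm_apply_apply _)

/-- The isomorphism between `Tor_*(R/I, gr_I^*(R))` and the twisted tensor product. -/
noncomputable def torGrEquiv : TorGr I ≃ₗ[R ⧸ I] Twisted (R ⧸ I) n :=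
  (((DFinsupp.mapRange.linearEquiv (torPieceEquiv r hI hr)).trans
    (TensorProduct.directSum (R ⧸ I) (R ⧸ I)
      (fun s : ℕ => homogeneousSubmodule (Fin n) (R ⧸ I) s)
      (fun k : ℕ => ⋀[R ⧸ I]^k (Fin n → R ⧸ I))).symm).trans
    (TensorProduct.comm (R ⧸ I) _ _)).trans
    (GradedTensorProduct.auxEquiv (R ⧸ I) (fun k : ℕ => ⋀[R ⧸ I]^k (Fin n → R ⧸ I))
      (homogeneousSubmodule (Fin n) (R ⧸ I))).symm

theorem torGrEquiv_lof (p : ℕ × ℕ) (x : TorPiece I p)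
    (F : homogeneousSubmodule (Fin n) (R ⧸ I) p.1) (u : ⋀[R ⧸ I]^p.2 (Fin n → R ⧸ I))
    (h : torPieceEquiv r hI hr p x = F ⊗ₜ u) :
    torGrEquiv r hI hr (lof (R ⧸ I) (ℕ × ℕ) (TorPiece I) p x) =
      GradedTensorProduct.tmul (R ⧸ I) (u : ExteriorAlgebra (R ⧸ I) (Fin n → R ⧸ I))
        (F : MvPolynomial (Fin n) (R ⧸ I)) := by
  have e1 : DFinsupp.mapRange.linearEquiv (torPieceEquiv r hI hr)
      (lof (R ⧸ I) (ℕ × ℕ) (TorPiece I) p x) =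
      lof (R ⧸ I) (ℕ × ℕ) (fun p => homogeneousSubmodule (Fin n) (R ⧸ I) p.1 ⊗[R ⧸ I]
        ⋀[R ⧸ I]^p.2 (Fin n → R ⧸ I)) p (F ⊗ₜ u) := by
    rw [← h]
    exact DFinsupp.mapRange_single (hf := fun i => map_zero (torPieceEquiv r hI hr i))
  rw [torGrEquiv, LinearEquiv.trans_apply, LinearEquiv.trans_apply, LinearEquiv.trans_apply, e1,
    LinearEquiv.symm_apply_eq, GradedTensorProduct.auxEquiv_tmul]
  obtain ⟨s, k⟩ := p
  have e2 : (TensorProduct.directSum (R ⧸ I) (R ⧸ I)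
      (fun s : ℕ => homogeneousSubmodule (Fin n) (R ⧸ I) s)
      (fun k : ℕ => ⋀[R ⧸ I]^k (Fin n → R ⧸ I))).symm (lof (R ⧸ I) (ℕ × ℕ) _ (s, k) (F ⊗ₜ u)) =
      lof (R ⧸ I) ℕ _ s F ⊗ₜ lof (R ⧸ I) ℕ _ k u := by
    exact TensorProduct.directSum_symm_lof_tmul (R ⧸ I) (R ⧸ I)
      (M₁ := fun s : ℕ => homogeneousSubmodule (Fin n) (R ⧸ I) s)
      (M₂ := fun k : ℕ => ⋀[R ⧸ I]^k (Fin n → R ⧸ I)) s F k u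
  rw [e2, TensorProduct.comm_tmul, decompose_coe, decompose_coe]
  rfl

theorem torGrEquiv_lof_symm (p : ℕ × ℕ) (F : homogeneousSubmodule (Fin n) (R ⧸ I) p.1)
    (u : ⋀[R ⧸ I]^p.2 (Fin n → R ⧸ I)) :
    torGrEquiv r hI hr (lof (R ⧸ I) (ℕ × ℕ) (TorPiece I) p
      ((torPieceEquiv r hI hr p).symm (F ⊗ₜ u))) =
      GradedTensorProduct.tmul (R ⧸ I) (u : ExteriorAlgebra (R ⧸ I) (Fin n → R ⧸ I))
        (F : MvPolynomial (Fin n) (R ⧸ I)) :=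
  torGrEquiv_lof r hI hr p _ F u ((torPieceEquiv r hI hr p).apply_symm_apply (F ⊗ₜ u))

theorem torGrEquiv_koszulTor (p : ℕ × ℕ) (a : R ⧸ I) (u : ⋀[R]^p.2 (Fin n → R))
    (F : homogeneousSubmodule (Fin n) R p.1) :
    torGrEquiv r hI hr (of (TorPiece I) p (koszulTor r hI hr p (a ⊗ₜ (u ⊗ₜ F)))) =
      GradedTensorProduct.tmul (R ⧸ I) (extPowBase R (R ⧸ I) p.2 u :
          ExteriorAlgebra (R ⧸ I) (Fin n → R ⧸ I))
        ((a • homBase R (R ⧸ I) p.1 F : homogeneousSubmodule (Fin n) (R ⧸ I) p.1) :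
          MvPolynomial (Fin n) (R ⧸ I)) := by
  refine torGrEquiv_lof r hI hr p _ _ _ ?_
  rw [torPieceEquiv_koszulTor, TensorProduct.smul_tmul']

theorem torGrEquiv_one : torGrEquiv r hI hr 1 = 1 := by
  have h : (1 : TorGr I) = of (TorPiece I) 0 (koszulTor r hI hr 0
      (1 ⊗ₜ (onePow R n ⊗ₜ ⟨1, isHomogeneous_one _ _⟩))) := by
    rw [← gOne_eq_koszulTor]
    rfl
  rw [h, torGrEquiv_koszulTor, one_smul, coe_extPowBase, coe_homBase, onePow]
  rw [map_one, map_one]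
  rfl

/-- Both sides carry the sign with exponent `p.1 * q.2`: on the left it comes from `koszulMul`, on
the right from moving the form `F` of degree `p.1` past `v` of degree `q.2`. -/
theorem torGrEquiv_mul_koszulTor (p q : ℕ × ℕ) (a b : R ⧸ I) (u : ⋀[R]^p.2 (Fin n → R))
    (F : homogeneousSubmodule (Fin n) R p.1) (v : ⋀[R]^q.2 (Fin n → R))
    (G : homogeneousSubmodule (Fin n) R q.1) :
    torGrEquiv r hI hr (of (TorPiece I) p (koszulTor r hI hr p (a ⊗ₜ (u ⊗ₜ F))) *
        of (TorPiece I) q (koszulTor r hI hr q (b ⊗ₜ (v ⊗ₜ G)))) =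
      torGrEquiv r hI hr (of (TorPiece I) p (koszulTor r hI hr p (a ⊗ₜ (u ⊗ₜ F)))) *
        torGrEquiv r hI hr (of (TorPiece I) q (koszulTor r hI hr q (b ⊗ₜ (v ⊗ₜ G)))) := by
  have h : of (TorPiece I) p (koszulTor r hI hr p (a ⊗ₜ (u ⊗ₜ F))) *
        of (TorPiece I) q (koszulTor r hI hr q (b ⊗ₜ (v ⊗ₜ G))) =
      (-1 : ℤ) ^ (p.1 * q.2) • of (TorPiece I) (p + q) (koszulTor r hI hr (p + q) ((a * b) ⊗ₜ
        (extMul R n p.2 q.2 (p.2 + q.2) u v ⊗ₜ symMul R n p.1 q.1 F G))) := by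
    rw [← map_zsmul, ← map_zsmul]
    refine (DirectSum.of_mul_of _ _).trans (congrArg (of (TorPiece I) (p + q)) ?_)
    refine (pieceMul_koszulTor r hI hr p q _ _).trans (congrArg (koszulTor r hI hr (p + q)) ?_)
    exact (congrArg ((a * b) ⊗ₜ[R] ·) (koszulMul_tmul p.1 q.1 p.2 q.2 (p.2 + q.2) u F v G)).trans
      (TensorProduct.tmul_smul _ _ _)
  rw [h, map_zsmul, torGrEquiv_koszulTor, torGrEquiv_koszulTor, torGrEquiv_koszulTor,
    GradedTensorProduct.tmul_coe_mul_coe_tmul, Units.smul_def]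
  -- The graded tensor product takes its sign in the units of ℤ, the Koszul product in ℤ.
  have hz : ∀ (m : ℕ) (z : Twisted (R ⧸ I) n),
      (-1 : ℤ) ^ m • z = (((-1 : ℤˣ) ^ m : ℤˣ) : ℤ) • z := fun m z => by
    rw [Units.val_pow_eq_pow_val, Units.val_neg, Units.val_one]
  refine (hz _ _).trans (congrArg _ ?_)
  refine congrArg₂ (fun x y => GradedTensorProduct.tmul (R ⧸ I) x y) ?_ ?_
  · rw [coe_extPowBase, coe_extPowBase, coe_extPowBase, coe_extMul rfl, map_mul]
  · rw [Submodule.coe_smul, Submodule.coe_smul, Submodule.coe_smul, coe_homBase, coe_homBase,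
      coe_homBase, coe_symMul, map_mul, smul_mul_smul_comm]

theorem tmul_tmul_induction {A M N G : Type*} [AddCommGroup A] [Module R A] [AddCommGroup M]
    [Module R M] [AddCommGroup N] [Module R N] [AddCommGroup G] (g : A ⊗[R] (M ⊗[R] N) →+ G)
    {P : G → Prop} (zero : P 0) (add : ∀ x y, P x → P y → P (x + y))
    (tmul : ∀ a m n, P (g (a ⊗ₜ (m ⊗ₜ n)))) (z : A ⊗[R] (M ⊗[R] N)) : P (g z) := by
  induction z using TensorProduct.induction_on with
  | zero => rwa [map_zero]
  | add x y hx hy => rw [map_add]; exact add _ _ hx hy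
  | tmul a w =>
    induction w using TensorProduct.induction_on with
    | zero => rwa [TensorProduct.tmul_zero, map_zero]
    | add x y hx hy => rw [TensorProduct.tmul_add, map_add]; exact add _ _ hx hy
    | tmul m n => exact tmul a m n

theorem torGr_induction {P : TorGr I → Prop} (zero : P 0) (add : ∀ x y, P x → P y → P (x + y))
    (tmul : ∀ (p : ℕ × ℕ) (a : R ⧸ I) (u : ⋀[R]^p.2 (Fin n → R))
      (F : homogeneousSubmodule (Fin n) R p.1),
      P (of (TorPiece I) p (koszulTor r hI hr p (a ⊗ₜ (u ⊗ₜ F))))) (x : TorGr I) : P x := by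
  induction x using DirectSum.induction_on with
  | zero => exact zero
  | add x y hx hy => exact add x y hx hy
  | of p x =>
    obtain ⟨x, rfl⟩ := (koszulTor r hI hr p).surjective x
    exact tmul_tmul_induction ((of (TorPiece I) p).comp
      (koszulTor r hI hr p).toAddEquiv.toAddMonoidHom) zero add (tmul p) x

theorem torGrEquiv_mul (x y : TorGr I) :
    torGrEquiv r hI hr (x * y) = torGrEquiv r hI hr x * torGrEquiv r hI hr y := by
  induction x using torGr_induction r hI hr with
  | zero => rw [zero_mul, map_zero, zero_mul]
  | add x x' hx hx' => rw [add_mul, map_add, hx, hx', map_add, add_mul]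
  | tmul p a u F =>
    induction y using torGr_induction r hI hr with
    | zero => rw [mul_zero, map_zero, mul_zero]
    | add y y' hy hy' => rw [mul_add, map_add, hy, hy', map_add, mul_add]
    | tmul q b v G => exact torGrEquiv_mul_koszulTor r hI hr p q a b u F v G

/-- Pure tensors span, so the image of a component is spanned by the images of pure tensors. Applied
to the components of `TorGr`, this shows that the isomorphism respects the bigrading. -/
theorem map_range_eq_span {A X Y V W Z : Type*} [CommSemiring A] [AddCommMonoid X] [Module A X]
    [AddCommMonoid Y] [Module A Y] [AddCommMonoid V] [Module A V] [AddCommMonoid W] [Module A W]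
    [AddCommMonoid Z] [Module A Z] (l : V →ₗ[A] W) (e : W ≃ₗ[A] Z) (φ : V ≃ₗ[A] X ⊗[A] Y)
    (t : X → Y → Z) (h : ∀ x y, e (l (φ.symm (x ⊗ₜ y))) = t x y) :
    (LinearMap.range l).map e.toLinearMap = Submodule.span A {z | ∃ x y, z = t x y} := by
  refine le_antisymm ?_ (Submodule.span_le.2 ?_)
  · rintro _ ⟨_, ⟨v, rfl⟩, rfl⟩
    obtain ⟨w, rfl⟩ := φ.symm.surjective v
    change e (l (φ.symm w)) ∈ _
    induction w using TensorProduct.induction_on with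
    | zero => simp only [map_zero, zero_mem]
    | tmul x y => exact Submodule.subset_span ⟨x, y, h x y⟩
    | add w w' hw hw' => simp only [map_add]; exact add_mem hw hw'
  · rintro _ ⟨x, y, rfl⟩
    exact ⟨_, ⟨_, rfl⟩, h x y⟩

theorem map_range_lof_torGrEquiv_eq_span (p : ℕ × ℕ) :
    (LinearMap.range (lof (R ⧸ I) (ℕ × ℕ) (TorPiece I) p)).map
      (torGrEquiv r hI hr).toLinearMap = Submodule.span (R ⧸ I) {z |
        ∃ (F : homogeneousSubmodule (Fin n) (R ⧸ I) p.1) (u : ⋀[R ⧸ I]^p.2 (Fin n → R ⧸ I)),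
          z = (GradedTensorProduct.tmul (R ⧸ I) (u : ExteriorAlgebra (R ⧸ I) (Fin n → R ⧸ I))
            (F : MvPolynomial (Fin n) (R ⧸ I)) : Twisted (R ⧸ I) n)} :=
  map_range_eq_span (lof (R ⧸ I) (ℕ × ℕ) (TorPiece I) p) (torGrEquiv r hI hr)
    (torPieceEquiv r hI hr p) (fun (F : homogeneousSubmodule (Fin n) (R ⧸ I) p.1)
      (u : ⋀[R ⧸ I]^p.2 (Fin n → R ⧸ I)) => (GradedTensorProduct.tmul (R ⧸ I)
      (u : ExteriorAlgebra (R ⧸ I) (Fin n → R ⧸ I)) (F : MvPolynomial (Fin n) (R ⧸ I)) :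
        Twisted (R ⧸ I) n)) (torGrEquiv_lof_symm r hI hr p)

theorem map_range_lof_torGrEquiv (s k : ℕ) :
    (LinearMap.range (lof (R ⧸ I) (ℕ × ℕ) (TorPiece I) (s, k))).map
      (torGrEquiv r hI hr).toLinearMap = twistedPiece (R ⧸ I) n s k := by
  refine (map_range_lof_torGrEquiv_eq_span r hI hr (s, k)).trans
    (congrArg _ (Set.ext fun z => ⟨?_, ?_⟩))
  · rintro ⟨F, u, rfl⟩
    exact ⟨u, u.2, F, F.2, rfl⟩
  · rintro ⟨u, hu, F, hF, rfl⟩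
    exact ⟨⟨F, hF⟩, ⟨u, hu⟩, rfl⟩

end TorGrEquiv

end

end RegularTor

theorem mainTheorem6 {R : Type u} [CommRing R] {n : ℕ} (r : Fin n → R)
    (hr : RingTheory.Sequence.IsRegular R (List.ofFn r)) (I : Ideal R)
    (hI : I = Ideal.span (Set.range r)) :
    ∃ e : RegularTor.TorGr I ≃ₗ[R ⧸ I] RegularTor.Twisted (R ⧸ I) n,
      e 1 = 1 ∧
      (∀ a b : RegularTor.TorGr I, e (a * b) = e a * e b) ∧
      ∀ s k : ℕ,
        (LinearMap.range (DirectSum.lof (R ⧸ I) (ℕ × ℕ) (RegularTor.TorPiece I) (s, k))).map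
          e.toLinearMap = RegularTor.twistedPiece (R ⧸ I) n s k :=
  have hr' := RegularTor.isRegular_mem_of_mul_mem r hr
  ⟨RegularTor.torGrEquiv r hI hr', RegularTor.torGrEquiv_one r hI hr',
    RegularTor.torGrEquiv_mul r hI hr', RegularTor.map_range_lof_torGrEquiv r hI hr'⟩
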